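/- Let $\Lambda$ be a commutative noetherian complete local domain with fraction field $K$, let $A$ be a separable $K$-algebra (finite dimensional, and semisimple after every extension of the base field), and let $R\subset A$ be a $\Lambda$-order, i.e. a $\Lambda$-subalgebra that is a finitely generated $\Lambda$-module and spans $A$ over $K$. Let $S\subset\Lambda\setminus\{0\}$ be a multiplicative set with $1 \in S$. Let $\mathcal M$ be the category of finitely generated left $R$-modules in which every element is annihilated by an element of $S$, and let $\mathcal P\subset\mathcal M$ consist of the modules of projective dimension $\le 1$ over $R$. Let $\mathrm{nr}\colon M_a(A)\to Z(A)$ be the reduced norm, with values in the centre of $A$ (identified with the centre of $M_a(A)$). Let $\mathcal I(R)\subset Z(A)$ be the $Z(R)$-module generated by $\mathrm{nr}(H)$ for all $H\in M_a(R)$, $a\ge 1$; it is a subring of $Z(A)$. For a homomorphism $h\colon R^b\to R^a$ of left modules, identified with its matrix with respect to the standard bases (acting on row vectors from the right, so that a maximal square submatrix is obtained by choosing the images of $a$ of the $b$ basis vectors), let $\mathrm{Fitt}_R(h)$ be the ideal of $\mathcal I(R)$ generated by $\mathrm{nr}(H)$ for all $a\times a$ submatrices $H$ of $h$. For a finitely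 generated left $R$-module $M$, let $\mathrm{Fitt}^{\max}_R(M)$ be the largest of the ideals $\mathrm{Fitt}_R(h)$, where $R^b\xrightarrow{h}R^a\to M\to0$ runs over all finite presentations of $M$. Let $\overline S\subset\mathcal I(R)$ be the image of $S$ under $\mathrm{nr}\colon R\to\mathcal I(R)$, and let $\Omega$ be the commutative monoid, under multiplication, of finitely generated $\mathcal I(R)$-submodules of $\overline S^{-1}\mathcal I(R)$. Suppose that every $P\in\mathcal P$ has a quadratic presentation, i.e. an exact sequence $R^a\to R^a\to P\to0$ for some $a$. Then: 1. for every finitely generated left $R$-module $M$ the largest ideal $\mathrm{Fitt}^{\max}_R(M)$ exists; 2. the assignment $\mathcal F(M)=\mathrm{Fitt}^{\max}_R(M)$, regarded as an $\mathcal I(R)$-submodule of $\overline S^{-1}\mathcal I(R)$, is a map $\mathcal F\colon\mathcal M\to\Omega$ and it is a Fitting invariant: $\mathcal F(P)$ is invertible in $\Omega$ for every $P\in\mathcal P$, and for every exact sequence $0\to M'\to M\to P\to0$ in $\mathcal M$ with $P\in\mathcal P$ one has $\mathcal F(M)=\mathcal F(P)\,\mathcal F(M')$. -/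

import Mathlib

open scoped TensorProduct
open CategoryTheory

universe u v w x

noncomputable section

namespace NCFitting

/-! ### Finitely generated torsion modules and Fitting invariants -/

section General

variable {R : Type u} [Ring R] (S : Submonoid R)

/-- A left `R`-module is in `𝓜` if it is finitely generated and `S`-torsion, that is, every
element is annihilated by an element of `S`. -/
def fgTorsion : ObjectProperty (ModuleCat.{u} R) := fun M =>
  Module.Finite R M ∧ ∀ m : M, ∃ s ∈ S, s • m = 0

/-- The category `𝓜` of finitely generated `S`-torsion left `R`-modules. -/
abbrev TorsionModule : Type (u + 1) := (fgTorsion S).FullSubcategory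

/-- Membership in `𝓟`: the projective dimension over `R` is at most `1`. -/
def InP (P : ModuleCat.{u} R) : Prop := HasProjectiveDimensionLE P 1

/-- A quadratic presentation `R^a → R^a → P → 0` exists. -/
def HasQuadraticPresentation (P : ModuleCat.{u} R) : Prop :=
  ∃ (a : ℕ) (h : (Fin a → R) →ₗ[R] (Fin a → R)) (g : (Fin a → R) →ₗ[R] P),
    Function.Exact h g ∧ Function.Surjective g

/-- A Fitting invariant `F : 𝓜 → Ω` with values in a commutative monoid. -/
structure IsFittingInvariant {Ω : Type x} [CommMonoid Ω] (F : TorsionModule S → Ω) : Prop where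
  isUnit : ∀ P : TorsionModule S, InP P.obj → IsUnit (F P)
  mul : ∀ (M' M P : TorsionModule S) (i : M'.obj →ₗ[R] M.obj) (q : M.obj →ₗ[R] P.obj),
    Function.Injective i → Function.Exact i q → Function.Surjective q → InP P.obj →
      F M = F P * F M'

end General

/-! ### Separable algebras, orders, reduced norms -/

/-- A separable algebra over a field `K`: finite dimensional, and semisimple after every extension
of the base field. -/
structure IsSeparableAlgebra (K : Type v) (A : Type w) [Field K] [Ring A] [Algebra K A] :
    Prop where
  finite : Module.Finite K A
  semisimple : ∀ (L : Type v) [Field L] [Algebra K L], IsSemisimpleRing (L ⊗[K] A)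

section Order

variable {Λ : Type u} (K : Type v) {A : Type w} [CommRing Λ] [Field K] [Ring A]
  [Algebra K A] [Algebra Λ A]

/-- `R` is a `Λ`-order of the `K`-algebra `A`, where `K` is the fraction field of `Λ`: a
`Λ`-subalgebra that is a finitely generated `Λ`-module and spans `A` over `K`. -/
structure IsOrder (R : Subalgebra Λ A) : Prop where
  finite : Module.Finite Λ R
  span : Submodule.span K (R : Set A) = ⊤

/-- `c ∈ Z(A)` is the reduced norm of the square matrix `H` over the separable `K`-algebra `A`.
With `E` a separable closure of `K` (which splits `A`), the `K`-algebra maps `ρ : A → M_n(E)` whose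
image spans `M_n(E)` over `E` are, up to conjugation, the projections from `A` to the simple
factors of `E ⊗ A`.  Applying `ρ` to the entries of `H` gives the corresponding projection of the
algebra of matrices over `A`, and the component of the reduced norm there is the determinant. -/
def IsReducedNorm {ι : Type} [Fintype ι] [DecidableEq ι] (H : Matrix ι ι A)
    (c : Subalgebra.center K A) : Prop :=
  ∀ (n : ℕ) (ρ : A →ₐ[K] Matrix (Fin n) (Fin n) (SeparableClosure K)),
    Submodule.span (SeparableClosure K) (Set.range ρ) = ⊤ →
      ρ (c : A) = Matrix.scalar (Fin n) (Matrix.comp ι ι (Fin n) (Fin n) _ (H.map ρ)).det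

open Classical in
/-- The reduced norm `nr : M_a(A) → Z(A)` of a separable `K`-algebra `A`. -/
def nr {ι : Type} [Fintype ι] [DecidableEq ι] (H : Matrix ι ι A) : Subalgebra.center K A :=
  if h : ∃ c, IsReducedNorm K H c then h.choose else 0

variable (R : Subalgebra Λ A)

/-- The reduced norm of a square matrix over `R`, regarded as a matrix over `A`. -/
def nrR {ι : Type} [Fintype ι] [DecidableEq ι] (H : Matrix ι ι R) : Subalgebra.center K A :=
  nr K (H.map (fun r : R => (r : A)))

/-- The subring `𝓘(R)` of `Z(A)` generated over `Z(R)` by the reduced norms of all square matrices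
over `R`.  As reduced norms of square matrices over `R` are closed under products (use block
diagonal matrices), it is the `Z(R)`-module that they generate. -/
def normRing : Subring (Subalgebra.center K A) :=
  Subring.closure
    ({z | ∃ r ∈ Subring.center R, (r : A) = z} ∪
      {z | ∃ (a : ℕ) (H : Matrix (Fin a) (Fin a) R), z = nrR K R H})

variable {R} in
/-- The Fitting invariant of a homomorphism `h : R^b → R^a` of left modules: the ideal of `𝓘(R)`
generated by the reduced norms of the `a × a` submatrices of `h`.  The matrix of `h` acts on row
vectors from the right, as it has to for left modules: its `b` rows are the images of the basis
vectors, and an `a × a` submatrix is a choice of `a` rows. -/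
def fitt {a b : ℕ} (h : (Fin b → R) →ₗ[R] (Fin a → R)) : Ideal (normRing K R) :=
  Ideal.span {z | ∃ s : Fin a ↪o Fin b,
    (z : Subalgebra.center K A) = nrR K R ((LinearMap.toMatrixRight' h).submatrix s id)}

/-- The set of the Fitting invariants of all finite presentations `R^b → R^a → M → 0`. -/
def fittSet (M : ModuleCat.{w} R) : Set (Ideal (normRing K R)) :=
  {I | ∃ (a b : ℕ) (h : (Fin b → R) →ₗ[R] (Fin a → R)) (g : (Fin a → R) →ₗ[R] M),
    Function.Exact h g ∧ Function.Surjective g ∧ I = fitt K h}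

/-- The maximal Fitting invariant of `M`: the largest Fitting invariant of a finite presentation,
written as a supremum. -/
def fittMax (M : ModuleCat.{w} R) : Ideal (normRing K R) := sSup (fittSet K R M)

/-- The multiplicative set `S̄` of `𝓘(R)`, the image of `S ⊆ Λ` under `nr : R → 𝓘(R)`.  (The
image of `S` is closed under products, since `nr` is multiplicative.) -/
def nrSubmonoid (S : Submonoid Λ) : Submonoid (normRing K R) :=
  Submonoid.closure {z | ∃ s ∈ S, (z : Subalgebra.center K A) =
    nrR K R (Matrix.of fun _ _ : Fin 1 => algebraMap Λ R s)}

/-- The commutative monoid `Ω` of finitely generated `𝓘(R)`-submodules of `S̄⁻¹𝓘(R)`, under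
multiplication of submodules. -/
def fracIdeals (S : Submonoid Λ) :
    Submonoid (Submodule (normRing K R) (Localization (nrSubmonoid K R S))) where
  carrier := {N | N.FG}
  one_mem' := by
    change Submodule.FG 1
    rw [Submodule.one_eq_span]
    exact Submodule.fg_span_singleton _
  mul_mem' h h' := Submodule.FG.mul h h'

end Order

end NCFitting

end

/-! Over a separable closure `E` of `K`, the algebra `E ⊗ A` is a product of matrix algebras over
`E`. Each factor gives a representation of `A`, hence a determinant for matrices over `A`, and
Galois descent shows that the tuple of determinants comes from `Z(A)`
(`Splitting.exists_isReducedNormOver`). These representations jointly separate points, so the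
reduced norm inherits the product and block-triangular rules of determinants.

The Fitting ideals of the presentations of a module are directed (`directedOn_fittSet`), so a
largest one exists once `𝓘(R)` is noetherian. The issue is that matrices of all sizes occur.
`exists_fg_matDet_mem` bounds their determinants: `det H` is the top coefficient of `det (1 + tH)`;
elimination over `R[[t]]` replaces `1 + tH` by a single `d ∈ R[[t]]`; and the coefficients of `det
d` are `Λ`-combinations of the coefficients of one polynomial, fixed by generators of `R` over `Λ`.

For multiplicativity, let the square matrix `H` present `P`. Torsion gives `X * H = s` with `s ∈ S`,
so `H` has independent rows and `nr H` becomes a unit in `S̄⁻¹𝓘(R)`. The horseshoe lemma gives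
`nr(H) Fitt(M') ⊆ Fitt(M)`. Conversely, after adding generators, `M` and `P` are presented on the
same generators, with a square matrix `G` for `P` such that `nr G = nr H`; the matrix of `M` is then
`k' * G` with `k'` presenting `M'` (`IsPresentation.exists_eq_mul`). The case `M' = 0` shows that
`Fitt(P)` is generated by `nr H`. -/

namespace NCFitting

/-! ### Determinants through a matrix representation -/

section MatDet

variable {Q C n : Type*} [Ring Q] [CommRing C] [Fintype n] [DecidableEq n]

/-- The determinant of a square matrix over `Q` with respect to a matrix representation `p` of
`Q`. -/
noncomputable def matDet (p : Q →+* Matrix n n C) {ι : Type*} [Fintype ι] [DecidableEq ι]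
    (H : Matrix ι ι Q) : C :=
  (Matrix.comp ι ι n n C (H.map p)).det

variable (p : Q →+* Matrix n n C)
  {ι κ : Type*} [Fintype ι] [DecidableEq ι] [Fintype κ] [DecidableEq κ]

theorem matDet_one : matDet p (1 : Matrix ι ι Q) = 1 := by
  rw [matDet, Matrix.map_one _ (map_zero p) (map_one p), Matrix.comp_one, Matrix.det_one]

theorem matDet_mul (H₁ H₂ : Matrix ι ι Q) : matDet p (H₁ * H₂) = matDet p H₁ * matDet p H₂ := by
  rw [matDet, Matrix.map_mul, ← Matrix.compRingEquiv_apply, map_mul, Matrix.det_mul]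
  rfl

theorem matDet_submatrix_equiv (e : κ ≃ ι) (H : Matrix ι ι Q) :
    matDet p (H.submatrix e e) = matDet p H :=
  Matrix.det_submatrix_equiv_self (e.prodCongr (Equiv.refl n)) (Matrix.comp ι ι n n C (H.map p))

omit [Fintype ι] [DecidableEq ι] [Fintype κ] [DecidableEq κ] in
-- Distributing the index set `(ι ⊕ κ) × n` keeps block-triangular shape, so the determinant rules
-- over `C` apply to blocks over `Q`.
theorem comp_map_fromBlocks_submatrix (A : Matrix ι ι Q) (B : Matrix ι κ Q) (D : Matrix κ ι Q)
    (F : Matrix κ κ Q) :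
    (Matrix.comp _ _ n n C ((Matrix.fromBlocks A B D F).map p)).submatrix
        (Equiv.sumProdDistrib ι κ n).symm (Equiv.sumProdDistrib ι κ n).symm =
      Matrix.fromBlocks (Matrix.comp _ _ _ _ _ (A.map p)) (Matrix.comp _ _ _ _ _ (B.map p))
        (Matrix.comp _ _ _ _ _ (D.map p)) (Matrix.comp _ _ _ _ _ (F.map p)) := by
  ext (⟨i, a⟩ | ⟨i, a⟩) (⟨j, b⟩ | ⟨j, b⟩) <;> rfl

theorem matDet_fromBlocks_zero₁₂ (A : Matrix ι ι Q) (D : Matrix κ ι Q) (F : Matrix κ κ Q) :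
    matDet p (Matrix.fromBlocks A 0 D F) = matDet p A * matDet p F := by
  rw [matDet, ← Matrix.det_submatrix_equiv_self (Equiv.sumProdDistrib ι κ n).symm,
    comp_map_fromBlocks_submatrix, Matrix.map_zero _ (map_zero p)]
  exact Matrix.det_fromBlocks_zero₁₂ _ _ _

theorem matDet_fromBlocks_zero₂₁ (A : Matrix ι ι Q) (B : Matrix ι κ Q) (F : Matrix κ κ Q) :
    matDet p (Matrix.fromBlocks A B 0 F) = matDet p A * matDet p F := by
  rw [matDet, ← Matrix.det_submatrix_equiv_self (Equiv.sumProdDistrib ι κ n).symm,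
    comp_map_fromBlocks_submatrix, Matrix.map_zero _ (map_zero p)]
  exact Matrix.det_fromBlocks_zero₂₁ _ _ _

theorem matDet_unique [Unique ι] (H : Matrix ι ι Q) :
    matDet p H = (p (H default default)).det := by
  rw [matDet, ← Matrix.det_submatrix_equiv_self (Equiv.uniqueProd n ι).symm]
  congr 1

/-- A matrix that becomes the identity under a homomorphism reflecting units near `1` has the
same determinant as some element of the ring. -/
theorem exists_matDet_eq_det {T : Type*} [Ring T] (c : Q →+* T)
    (hc : ∀ x, c x = 1 → IsUnit x) (a : ℕ) (H : Matrix (Fin a) (Fin a) Q)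
    (hH : H.map c = 1) : ∃ d, matDet p H = (p d).det := by
  induction a with
  | zero =>
    refine ⟨1, ?_⟩
    rw [Subsingleton.elim H 1, matDet_one, map_one, Matrix.det_one]
  | succ a ih =>
    let e : Fin 1 ⊕ Fin a ≃ Fin (a + 1) := finSumFinEquiv.trans (finCongr (add_comm 1 a))
    set G := H.submatrix e e with hG
    have hGc : G.map c = 1 := by
      rw [hG, ← Matrix.submatrix_map, hH, Matrix.submatrix_one_equiv]
    have hentry : ∀ i j, c (G i j) = (1 : Matrix (Fin 1 ⊕ Fin a) (Fin 1 ⊕ Fin a) T) i j :=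
      fun i j => by rw [← hGc]; rfl
    obtain ⟨α, hα⟩ := hc (G (.inl 0) (.inl 0)) (by rw [hentry]; simp)
    let B := G.toBlocks₁₂
    let D := G.toBlocks₂₁
    let s : Matrix (Fin 1) (Fin 1) Q := Matrix.scalar _ (↑α⁻¹ : Q)
    have hA : G.toBlocks₁₁ = Matrix.scalar (Fin 1) (α : Q) := by
      ext i j
      fin_cases i; fin_cases j
      simpa [Matrix.toBlocks₁₁] using hα.symm
    have hAs : G.toBlocks₁₁ * s = 1 := by
      rw [hA, ← map_mul, Units.mul_inv, map_one]
    have hsA : s * G.toBlocks₁₁ = 1 := by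
      rw [hA, ← map_mul, Units.inv_mul, map_one]
    -- One step of block elimination, possible because the corner entry is a unit.
    have hfac : G = Matrix.fromBlocks 1 0 (D * s) 1 *
        Matrix.fromBlocks G.toBlocks₁₁ B 0 (G.toBlocks₂₂ - D * s * B) := by
      conv_lhs => rw [← Matrix.fromBlocks_toBlocks G]
      rw [Matrix.fromBlocks_multiply]
      simp [B, D, Matrix.mul_assoc, hsA]
    -- The Schur complement again maps to the identity, since `B` maps to zero.
    obtain ⟨d, hd⟩ := ih (G.toBlocks₂₂ - D * s * B) (by
      have hB : B.map c = 0 := by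
        ext i j
        exact (hentry _ _).trans (by simp)
      have h2 : G.toBlocks₂₂.map c = 1 := by
        ext i j
        exact (hentry _ _).trans (by simp [Matrix.one_apply])
      rw [Matrix.map_sub _ (map_sub c), Matrix.map_mul, hB, h2]
      simp)
    refine ⟨α * d, ?_⟩
    rw [← matDet_submatrix_equiv p e H, ← hG, hfac, matDet_mul, matDet_fromBlocks_zero₁₂,
      matDet_one, matDet_one, matDet_fromBlocks_zero₂₁, hd, matDet_unique, map_mul,
      Matrix.det_mul, one_mul, one_mul, hα]
    rfl

end MatDet

/-! ### Passing to power series -/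

section PowerSeriesRep

variable {R C n : Type*} [Ring R] [CommRing C] [Fintype n] [DecidableEq n]

/-- The extension of a matrix representation to power series. -/
noncomputable def powerSeriesRep (p : R →+* Matrix n n C) :
    PowerSeries R →+* Matrix n n (PowerSeries C) where
  toFun f := Matrix.of fun i j => PowerSeries.mk fun k => p (PowerSeries.coeff k f) i j
  map_one' := by
    ext i j k
    by_cases hij : i = j <;> by_cases hk : k = 0 <;>
      simp [PowerSeries.coeff_one, Matrix.one_apply, hij, hk]
  map_zero' := by ext i j k; simp
  map_add' f g := by ext i j k; simp
  map_mul' f g := by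
    ext i j k
    simp only [Matrix.of_apply, PowerSeries.coeff_mk, PowerSeries.coeff_mul, map_sum, map_mul,
      Matrix.sum_apply, Matrix.mul_apply]
    exact Finset.sum_comm

theorem coeff_powerSeriesRep (p : R →+* Matrix n n C) (f : PowerSeries R) (i j : n) (k : ℕ) :
    PowerSeries.coeff k (powerSeriesRep p f i j) = p (PowerSeries.coeff k f) i j := by
  simp [powerSeriesRep]

/-- The determinant of `H` is a coefficient of the determinant of `1 + t H`. -/
theorem matDet_eq_coeff (p : R →+* Matrix n n C) {ι : Type*} [Fintype ι] [DecidableEq ι]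
    (H : Matrix ι ι R) :
    matDet p H = PowerSeries.coeff (Fintype.card (ι × n))
      (matDet (powerSeriesRep p) (1 + H.map fun r => PowerSeries.X * PowerSeries.C r)) := by
  rw [matDet, ← Polynomial.coeff_det_X_add_C_card _ 1, ← Polynomial.coeff_coe, matDet]
  congr 1
  rw [← Polynomial.coeToPowerSeries.ringHom_apply, RingHom.map_det]
  congr 1
  ext ⟨i, a⟩ ⟨j, b⟩ k
  simp only [RingHom.mapMatrix_apply, Matrix.map_apply, Polynomial.coeToPowerSeries.ringHom_apply,
    Polynomial.coeff_coe, Matrix.comp_apply, coeff_powerSeriesRep, Matrix.add_apply, map_add,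
    Matrix.smul_apply, smul_eq_mul]
  rw [add_comm]
  congr 1
  · rw [Polynomial.coeff_C, Matrix.one_apply, Matrix.one_apply]
    by_cases hij : i = j <;> by_cases hab : a = b <;> by_cases hk : k = 0 <;>
      simp [PowerSeries.coeff_one, hij, hab, hk]
  · cases k with
    | zero => simp
    | succ k =>
      simp only [Polynomial.coeff_X_mul, PowerSeries.coeff_succ_X_mul, Polynomial.coeff_C,
        PowerSeries.coeff_C]
      split_ifs <;> simp

end PowerSeriesRep

/-! ### Determinants of all sizes lie in one finitely generated module -/

section Finiteness

variable {Λ R C n : Type*} [CommRing Λ] [Ring R] [Algebra Λ R] [CommRing C] [Algebra Λ C]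
  [Fintype n] [DecidableEq n]

open MvPolynomial in
-- Write `d = ∑ fᵢ rᵢ` with `fᵢ ∈ Λ[[t]]`. Its determinant is the polynomial `det (∑ Xᵢ p(rᵢ))`,
-- which does not depend on `d`, evaluated at the `fᵢ`; its finitely many coefficients span `W`.
theorem exists_fg_coeff_det_powerSeriesRep_mem [Module.Finite Λ R] (p : R →ₐ[Λ] Matrix n n C) :
    ∃ W : Submodule Λ C, W.FG ∧ ∀ (d : PowerSeries R) (N : ℕ),
      PowerSeries.coeff N (powerSeriesRep (p : R →+* Matrix n n C) d).det ∈ W := by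
  obtain ⟨m, r, hr⟩ := Module.Finite.exists_fin (R := Λ) (M := R)
  let G : Matrix n n (MvPolynomial (Fin m) C) :=
    Matrix.of fun i j => ∑ k, MvPolynomial.C (p (r k) i j) * X k
  let P := G.det
  refine ⟨Submodule.span Λ ((fun α => P.coeff α) '' (P.support : Set (Fin m →₀ ℕ))),
    Submodule.fg_span (P.support.finite_toSet.image _), fun d N => ?_⟩
  have hd : ∀ k, ∃ c : Fin m → Λ, ∑ i, c i • r i = PowerSeries.coeff k d := fun k =>
    (Submodule.mem_span_range_iff_exists_fun Λ).mp (by rw [hr]; trivial)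
  choose c hc using hd
  let f : Fin m → PowerSeries Λ := fun i => PowerSeries.mk fun k => c k i
  let φ : MvPolynomial (Fin m) C →+* PowerSeries C :=
    eval₂Hom PowerSeries.C fun i => PowerSeries.map (algebraMap Λ C) (f i)
  have hφ : powerSeriesRep (p : R →+* Matrix n n C) d = φ.mapMatrix G := by
    ext i j k
    rw [coeff_powerSeriesRep, ← hc]
    simp only [RingHom.mapMatrix_apply, Matrix.map_apply, G, Matrix.of_apply, map_sum, map_mul, φ,
      eval₂Hom_C, eval₂Hom_X', PowerSeries.coeff_C_mul, PowerSeries.coeff_map, f,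
      PowerSeries.coeff_mk, RingHom.coe_coe, map_smul, Matrix.sum_apply, Matrix.smul_apply]
    exact Finset.sum_congr rfl fun _ _ => (Algebra.smul_def _ _).trans (mul_comm _ _)
  rw [hφ, ← RingHom.map_det, show φ G.det = ∑ α ∈ P.support, PowerSeries.C (P.coeff α) *
    ∏ i, PowerSeries.map (algebraMap Λ C) (f i) ^ α i from eval₂_eq' _ _ _, map_sum]
  refine Submodule.sum_mem _ fun α hα => ?_
  simp only [← map_pow, ← map_prod]
  rw [PowerSeries.coeff_C_mul, PowerSeries.coeff_map, mul_comm, ← Algebra.smul_def]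
  exact Submodule.smul_mem _ _ (Submodule.subset_span ⟨α, hα, rfl⟩)

/-- The determinants of all square matrices over a finite algebra, in a fixed matrix
representation, lie in a finitely generated module. -/
theorem exists_fg_matDet_mem [Module.Finite Λ R] (p : R →ₐ[Λ] Matrix n n C) :
    ∃ W : Submodule Λ C, W.FG ∧ ∀ (a : ℕ) (H : Matrix (Fin a) (Fin a) R),
      matDet (p : R →+* Matrix n n C) H ∈ W := by
  obtain ⟨W, hW, h⟩ := exists_fg_coeff_det_powerSeriesRep_mem p
  refine ⟨W, hW, fun a H => ?_⟩
  obtain ⟨d, hd⟩ := exists_matDet_eq_det (powerSeriesRep (p : R →+* Matrix n n C))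
    (PowerSeries.constantCoeff (R := R)) (fun x hx => PowerSeries.isUnit_iff_constantCoeff.mpr
      (by rw [hx]; exact isUnit_one)) a
    (1 + H.map fun r => PowerSeries.X * PowerSeries.C r) (by
      ext i j : 2
      by_cases hij : i = j <;> simp [Matrix.one_apply, hij])
  rw [matDet_eq_coeff, hd]
  exact h d _

end Finiteness

/-! ### Separable algebras split over separably closed fields -/

section Splitting

/-- A complement of the left ideal `C t` yields `t = b t²`, and iterating, `t = bⁿ tⁿ⁺¹` for all
`n`. -/
theorem eq_zero_of_isNilpotent_of_mem_center {C : Type*} [Ring C] [IsSemisimpleRing C] {t : C}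
    (ht : t ∈ Subring.center C) (hn : IsNilpotent t) : t = 0 := by
  obtain ⟨J, hJ⟩ := exists_isCompl (Ideal.span {t})
  obtain ⟨a, ha, j, hj, haj⟩ := Submodule.mem_sup.mp (hJ.sup_eq_top ▸ Submodule.mem_top (x := 1))
  obtain ⟨b, rfl⟩ := Ideal.mem_span_singleton'.mp ha
  have h0 : t * j = 0 := by
    refine (Submodule.disjoint_def.mp hJ.disjoint) _ ?_ (J.mul_mem_left _ hj)
    rw [Subring.mem_center_iff.mp ht j |>.symm]
    exact Ideal.mul_mem_left _ _ (Ideal.mem_span_singleton_self t)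
  have h1 : t = b * t * t := by
    calc t = t * (b * t + j) := by rw [haj, mul_one]
      _ = t * (b * t) + t * j := mul_add _ _ _
      _ = b * t * t := by rw [h0, add_zero, ← Subring.mem_center_iff.mp ht]
  have h2 : ∀ n : ℕ, t = b ^ n * t ^ (n + 1) := by
    intro n
    induction n with
    | zero => simp
    | succ n ih =>
      have hc : Commute t b := (Subring.mem_center_iff.mp ht b).symm
      calc t = b * t * t := h1
        _ = b * t * (b ^ n * t ^ (n + 1)) := by rw [← ih]
        _ = b * (t * b ^ n) * t ^ (n + 1) := by simp only [mul_assoc]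
        _ = b ^ (n + 1) * t ^ (n + 1 + 1) := by
          rw [(hc.pow_right n).eq, ← mul_assoc, ← pow_succ', mul_assoc, ← pow_succ']
  obtain ⟨n, hn⟩ := hn
  rw [h2 n, pow_succ, hn, zero_mul, mul_zero]

theorem tmul_mem_center {E Ω B : Type*} [Field E] [Field Ω] [Algebra E Ω] [Ring B] [Algebra E B]
    (μ : Ω) {y : B} (hy : y ∈ Subring.center B) : μ ⊗ₜ[E] y ∈ Subring.center (Ω ⊗[E] B) := by
  rw [Subring.mem_center_iff] at hy ⊢
  intro z
  induction z with
  | zero => simp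
  | tmul a b => simp [hy b, mul_comm]
  | add a b ha hb => rw [add_mul, mul_add, ha, hb]

/-- In an algebra that stays semisimple over an algebraically closed extension, a central element
with a `p`-power proportional to a central idempotent is itself proportional to it. -/
theorem exists_eq_smul_of_pow_eq {E Ω B : Type*} [Field E] [Field Ω] [Algebra E Ω] [IsAlgClosed Ω]
    [Ring B] [Algebra E B] [IsSemisimpleRing (Ω ⊗[E] B)] {e y : B}
    (he : e ∈ Subring.center B) (hy : y ∈ Subring.center B) (hee : e * e = e)
    (q : ℕ) [ExpChar E q] (n : ℕ) (c : E) (h : y ^ q ^ n = c • e) : ∃ b : E, y = b • e := by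
  have hq : q ^ n ≠ 0 := (expChar_pow_pos E q n).ne'
  obtain ⟨μ, hμ⟩ := IsAlgClosed.exists_pow_nat_eq (algebraMap E Ω c) (Nat.pos_of_ne_zero hq)
  have hpow : e ^ q ^ n = e := IsIdempotentElem.pow_eq hee hq
  have hcen : (1 : Ω) ⊗ₜ[E] y - μ ⊗ₜ[E] e ∈ Subring.center (Ω ⊗[E] B) :=
    sub_mem (tmul_mem_center _ hy) (tmul_mem_center _ he)
  -- By Frobenius, the `q ^ n`-th power of this central element is `1 ⊗ c e - μ ^ q ^ n ⊗ e = 0`.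
  have h0 : (1 : Ω) ⊗ₜ[E] y - μ ⊗ₜ[E] e = 0 := by
    nontriviality Ω ⊗[E] B
    have : ExpChar (Ω ⊗[E] B) q := expChar_of_injective_algebraMap
      (FaithfulSMul.algebraMap_injective E (Ω ⊗[E] B)) q
    refine eq_zero_of_isNilpotent_of_mem_center hcen ⟨q ^ n, ?_⟩
    rw [sub_pow_expChar_pow_of_commute q n
      (Subring.mem_center_iff.mp (tmul_mem_center (E := E) μ he) _)]
    rw [Algebra.TensorProduct.tmul_pow, Algebra.TensorProduct.tmul_pow, h, hpow, hμ, one_pow,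
      TensorProduct.tmul_smul, TensorProduct.smul_tmul', Algebra.smul_def, mul_one, sub_self]
  by_contra hne
  -- A functional killing `e` but not `y`, extended to `Ω`, contradicts `h0`.
  obtain ⟨f, hf, hle⟩ := Submodule.exists_le_ker_of_notMem (p := Submodule.span E {e}) (v := y)
    (fun hmem => hne (by
      obtain ⟨b, hb⟩ := Submodule.mem_span_singleton.mp hmem
      exact ⟨b, hb.symm⟩))
  have hfe : f e = 0 := hle (Submodule.mem_span_singleton_self e)
  have := congrArg (TensorProduct.rid E Ω) (congrArg (LinearMap.lTensor Ω f) h0)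
  simp [hfe, Algebra.smul_def] at this
  exact hf this

/-- The field `E[X]/(minpoly)` generated by `y` is finite over a separably closed field, hence
purely inseparable. -/
theorem exists_pow_eq_algebraMap {E D : Type*} [Field E] [IsSepClosed E] [Ring D]
    [IsDomain D] [Algebra E D] [Algebra.IsIntegral E D] (q : ℕ) [ExpChar E q] (y : D) :
    ∃ (n : ℕ) (c : E), y ^ q ^ n = algebraMap E D c := by
  have hint : IsIntegral E y := Algebra.IsIntegral.isIntegral y
  have : Fact (Irreducible (minpoly E y)) := ⟨minpoly.irreducible hint⟩
  have : Module.Finite E (AdjoinRoot (minpoly E y)) := (minpoly.monic hint).finite_adjoinRoot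
  obtain ⟨n, c, hc⟩ := IsPurelyInseparable.pow_mem E q (AdjoinRoot.root (minpoly E y))
  have key : AdjoinRoot.mk (minpoly E y) (Polynomial.X ^ q ^ n - Polynomial.C c) = 0 := by
    rw [map_sub, map_pow, AdjoinRoot.mk_X, AdjoinRoot.mk_C, ← hc, AdjoinRoot.algebraMap_eq, sub_self]
  obtain ⟨g, hg⟩ := AdjoinRoot.mk_eq_zero.mp key
  refine ⟨n, c, ?_⟩
  have := congrArg (Polynomial.aeval y) hg
  rw [map_mul, minpoly.aeval, zero_mul] at this
  simpa [sub_eq_zero] using this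

/-- A finite dimensional division algebra over a separably closed field with trivial centre is
trivial. -/
theorem algebraMap_bijective_of_center_le {E D : Type*} [Field E] [IsSepClosed E]
    [DivisionRing D] [Algebra E D] [Module.Finite E D]
    (h : ∀ y ∈ Subring.center D, ∃ b : E, y = algebraMap E D b) :
    Function.Bijective (algebraMap E D) := by
  refine ⟨(algebraMap E D).injective, fun x => ?_⟩
  have : Algebra.IsCentral E D := ⟨fun y hy => by
    obtain ⟨b, rfl⟩ := h y hy
    exact Subalgebra.algebraMap_mem _ b⟩
  -- By Jacobson–Noether a noncommutative `D` would contain a noncentral separable element, whose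
  -- minimal polynomial over `E` has degree one.
  have htop : (⊥ : Subalgebra E D) = ⊤ := by
    by_contra hne
    obtain ⟨x, hx, hsep⟩ := JacobsonNoether.exists_separable_and_not_isCentral' hne
    exact hx (minpoly.mem_range_of_degree_eq_one E x
      (IsSepClosed.degree_eq_one_of_irreducible E
        (minpoly.irreducible (Algebra.IsIntegral.isIntegral x)) hsep))
  exact (htop ▸ Algebra.mem_top : x ∈ (⊥ : Subalgebra E D))

theorem isSemisimpleRing_tensor_tensor {K : Type v} {A : Type w} [Field K] [Ring A] [Algebra K A]
    (hA : IsSeparableAlgebra K A) (E Ω : Type v) [Field E] [Field Ω] [Algebra K E] [Algebra E Ω] :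
    IsSemisimpleRing (Ω ⊗[E] (E ⊗[K] A)) := by
  let _ : Algebra K Ω := ((algebraMap E Ω).comp (algebraMap K E)).toAlgebra
  have : IsScalarTower K E Ω := IsScalarTower.of_algebraMap_eq fun _ => rfl
  have := hA.semisimple Ω
  let e : Ω ⊗[E] (E ⊗[K] A) ≃ₐ[K] Ω ⊗[K] A :=
    ((Algebra.TensorProduct.assoc K E E Ω E A).symm.restrictScalars K).trans
      (Algebra.TensorProduct.congr ((Algebra.TensorProduct.rid E E Ω).restrictScalars K) AlgEquiv.refl)
  exact e.symm.toRingEquiv.isSemisimpleRing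

/-- By Wedderburn it remains to show that the division algebras equal `E`. Semisimplicity over `Ω`
excludes inseparable centres: a central `y` has a `q ^ n`-th power in `E`, so the central element of
`B` that it defines is proportional to the idempotent of its factor. -/
theorem exists_algEquiv_pi_matrix_of_isSepClosed {E : Type*} (Ω : Type*) {B : Type u} [Field E]
    [IsSepClosed E] [Field Ω] [IsAlgClosed Ω] [Algebra E Ω] [Ring B] [Algebra E B]
    [Module.Finite E B] [IsSemisimpleRing B] [IsSemisimpleRing (Ω ⊗[E] B)] :
    ∃ (r : ℕ) (d : Fin r → ℕ), (∀ i, NeZero (d i)) ∧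
      Nonempty (B ≃ₐ[E] Π i, Matrix (Fin (d i)) (Fin (d i)) E) := by
  obtain ⟨r, D, d, _, _, _, hd, ⟨Φ⟩⟩ :=
    IsSemisimpleRing.exists_algEquiv_pi_matrix_divisionRing_finite E B
  refine ⟨r, d, hd, ?_⟩
  obtain ⟨q, hq⟩ := ExpChar.exists E
  have hbij : ∀ i, Function.Bijective (algebraMap E (D i)) := by
    intro i
    refine algebraMap_bijective_of_center_le fun y hy => ?_
    let s : D i → Π i, Matrix (Fin (d i)) (Fin (d i)) (D i) := fun z =>
      Pi.single i (Matrix.scalar _ z)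
    have hs : ∀ z ∈ Subring.center (D i), Φ.symm (s z) ∈ Subring.center B := by
      intro z hz
      rw [Subring.mem_center_iff]
      intro t
      obtain ⟨t, rfl⟩ := Φ.symm.surjective t
      rw [← map_mul, ← map_mul]
      congr 1
      ext j : 1
      by_cases hij : j = i
      · subst hij
        simp only [s, Pi.mul_apply, Pi.single_eq_same]
        exact (Matrix.scalar_commute z (fun w => (Subring.mem_center_iff.mp hz w).symm) _).symm
      · simp [s, hij]
    have hsp : ∀ z (m : ℕ), m ≠ 0 → s z ^ m = s (z ^ m) := fun z m hm => by
      ext j : 1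
      by_cases hij : j = i
      · subst hij
        simp only [s, Pi.pow_apply, Pi.single_eq_same, map_pow]
      · simp [s, hij, Pi.pow_apply, hm]
    have hsmul : ∀ c : E, s (algebraMap E (D i) c) = c • s 1 := fun c => by
      simp only [s, ← Pi.single_smul]
      congr 1
      ext a b
      by_cases hab : a = b <;> simp [hab, Algebra.smul_def]
    obtain ⟨n, c, hc⟩ := exists_pow_eq_algebraMap (E := E) q y
    have hidem : Φ.symm (s 1) * Φ.symm (s 1) = Φ.symm (s 1) := by
      rw [← map_mul, ← pow_two, hsp _ _ two_ne_zero, one_pow]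
    obtain ⟨b, hb⟩ := exists_eq_smul_of_pow_eq (Ω := Ω) (hs 1 (one_mem _)) (hs y hy) hidem q n c
      (by rw [← map_pow, hsp _ _ (expChar_pow_pos E q n).ne', hc, hsmul, map_smul])
    refine ⟨b, ?_⟩
    rw [← map_smul, ← hsmul] at hb
    have h1 := congrFun (Φ.symm.injective hb) i
    have h2 := congrFun (congrFun h1 0) 0
    simpa [s] using h2
  exact ⟨Φ.trans (AlgEquiv.piCongrRight fun i =>
    (AlgEquiv.ofBijective (Algebra.ofId E (D i)) (hbij i)).symm.mapMatrix)⟩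

/-- A separable algebra is split by every separably closed extension. -/
theorem IsSeparableAlgebra.exists_algEquiv_pi_matrix {K : Type v} {A : Type w} [Field K] [Ring A]
    [Algebra K A] (hA : IsSeparableAlgebra K A) (E : Type v) [Field E] [Algebra K E]
    [IsSepClosed E] :
    ∃ (r : ℕ) (d : Fin r → ℕ), (∀ i, NeZero (d i)) ∧
      Nonempty (E ⊗[K] A ≃ₐ[E] Π i, Matrix (Fin (d i)) (Fin (d i)) E) := by
  have := hA.semisimple E
  have := hA.finite
  have := isSemisimpleRing_tensor_tensor hA E (AlgebraicClosure E)
  exact exists_algEquiv_pi_matrix_of_isSepClosed (AlgebraicClosure E)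

end Splitting

/-! ### Surjective representations up to conjugation -/

section Representations

variable {E : Type*} [Field E]

open scoped Kronecker in
theorem matDet_conj {Q m n : Type*} [Ring Q] [Fintype m] [DecidableEq m] [Fintype n] [DecidableEq n]
    (p : Q →+* Matrix m m E) (ρ : Q →+* Matrix n n E) (T : Matrix n m E) (T' : Matrix m n E)
    (h₁ : T * T' = 1) (h₂ : T' * T = 1) (h : ∀ a, ρ a = T * p a * T')
    {ι : Type*} [Fintype ι] [DecidableEq ι] (H : Matrix ι ι Q) : matDet ρ H = matDet p H := by
  have hc : Matrix.comp ι ι n n E (H.map ρ) =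
      ((1 : Matrix ι ι E) ⊗ₖ T) * Matrix.comp ι ι m m E (H.map p) * ((1 : Matrix ι ι E) ⊗ₖ T') := by
    ext ⟨i, a⟩ ⟨j, b⟩
    simp [Matrix.mul_apply, h, Fintype.sum_prod_type, Matrix.one_apply]
  rw [matDet, hc, Matrix.det_conj_of_mul_eq_one]
  · rfl
  · rw [← Matrix.mul_kronecker_mul, h₁, one_mul, Matrix.one_kronecker_one]
  · rw [← Matrix.mul_kronecker_mul, h₂, one_mul, Matrix.one_kronecker_one]

theorem matDet_map {Q m C D : Type*} [Ring Q] [Fintype m] [DecidableEq m] [CommRing C] [CommRing D]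
    (p : Q →+* Matrix m m C) (σ : C →+* D) {ι : Type*} [Fintype ι] [DecidableEq ι]
    (H : Matrix ι ι Q) : matDet (σ.mapMatrix.comp p) H = σ (matDet p H) := by
  rw [matDet, matDet, RingHom.map_det]
  rfl

/-- Skolem–Noether: an isomorphism of endomorphism algebras is conjugation by a linear equivalence.
-/
theorem exists_conj_of_bijective {m n : ℕ} (θ : Matrix (Fin m) (Fin m) E →ₐ[E]
    Matrix (Fin n) (Fin n) E) (hθ : Function.Bijective θ) :
    ∃ (T : Matrix (Fin n) (Fin m) E) (T' : Matrix (Fin m) (Fin n) E),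
      T * T' = 1 ∧ T' * T = 1 ∧ ∀ x, θ x = T * x * T' := by
  let f : Module.End E (Fin m → E) ≃ₐ[E] Module.End E (Fin n → E) :=
    Matrix.toLinAlgEquiv'.symm.trans ((AlgEquiv.ofBijective θ hθ).trans Matrix.toLinAlgEquiv')
  obtain ⟨T, hT⟩ := f.eq_linearEquivConjAlgEquiv
  refine ⟨LinearMap.toMatrix' T.toLinearMap, LinearMap.toMatrix' T.symm.toLinearMap, ?_, ?_, ?_⟩
  · rw [← LinearMap.toMatrix'_comp]; simp
  · rw [← LinearMap.toMatrix'_comp]; simp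
  · intro x
    have h := congrArg (fun g => LinearMap.toMatrix' (g (Matrix.toLin' x))) hT
    have h1 : LinearMap.toMatrix' (f (Matrix.toLin' x)) = θ x := by
      change LinearMap.toMatrix' (Matrix.toLin' (θ (LinearMap.toMatrix' (Matrix.toLin' x)))) = _
      rw [LinearMap.toMatrix'_toLin', LinearMap.toMatrix'_toLin']
    rw [← h1]
    refine h.trans ?_
    simp only [LinearEquiv.conjAlgEquiv_apply]
    rw [LinearMap.toMatrix'_comp, LinearMap.toMatrix'_comp, LinearMap.toMatrix'_toLin',
      Matrix.mul_assoc]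

/-- A surjective representation of a product of matrix algebras is conjugate to a projection. -/
theorem exists_conj_of_surjective {r : ℕ} {d : Fin r → ℕ} [∀ i, NeZero (d i)] {n : ℕ} [NeZero n]
    (ψ : (Π i, Matrix (Fin (d i)) (Fin (d i)) E) →ₐ[E] Matrix (Fin n) (Fin n) E)
    (hψ : Function.Surjective ψ) :
    ∃ (i : Fin r) (T : Matrix (Fin n) (Fin (d i)) E) (T' : Matrix (Fin (d i)) (Fin n) E),
      T * T' = 1 ∧ T' * T = 1 ∧ ∀ x, ψ x = T * x i * T' := by
  -- The central idempotents `e i` sum to `1`, and `ψ` maps each to a central idempotent, which is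
  -- `0` or `1`; some image is `1`, and `ψ` then depends on that component only.
  let e : Fin r → Π i, Matrix (Fin (d i)) (Fin (d i)) E := fun i => Pi.single i 1
  have hsum : ∑ i, e i = 1 := Finset.univ_sum_single 1
  have hex : ∃ i, ψ (e i) ≠ 0 := by
    by_contra! h
    have := congrArg ψ hsum
    rw [map_sum, Finset.sum_eq_zero fun i _ => h i, map_one] at this
    exact zero_ne_one this
  obtain ⟨i, hi⟩ := hex
  have hee : e i * e i = e i := by simp only [e, ← Pi.single_mul, one_mul]
  have hcen : ψ (e i) ∈ Subalgebra.center E (Matrix (Fin n) (Fin n) E) := by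
    rw [Subalgebra.mem_center_iff]
    intro b
    obtain ⟨b, rfl⟩ := hψ b
    rw [← map_mul, ← map_mul]
    congr 1
    ext j : 1
    by_cases hij : j = i
    · subst hij; simp [e]
    · simp [e, hij]
  have hone : ψ (e i) = 1 := by
    rw [Algebra.IsCentral.center_eq_bot, Algebra.mem_bot] at hcen
    obtain ⟨c, hc⟩ := hcen
    have h2 : algebraMap E (Matrix (Fin n) (Fin n) E) (c * c) = algebraMap E _ c := by
      rw [map_mul, hc, ← map_mul, hee]
    have h3 : c * c = c := (algebraMap E (Matrix (Fin n) (Fin n) E)).injective h2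
    have hc0 : c ≠ 0 := by
      rintro rfl
      exact hi (by rw [← hc, map_zero])
    rw [← hc, mul_left_cancel₀ hc0 (h3.trans (mul_one c).symm), map_one]
  have hmul : ∀ x, ψ x = ψ (Pi.single i (x i)) := by
    intro x
    have : Pi.single i (x i) = e i * x := by
      ext j : 1
      by_cases hij : j = i
      · subst hij; simp [e]
      · simp [e, hij]
    rw [this, map_mul, hone, one_mul]
  let θ : Matrix (Fin (d i)) (Fin (d i)) E →ₐ[E] Matrix (Fin n) (Fin n) E :=
    AlgHom.ofLinearMap (ψ.toLinearMap ∘ₗ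
      LinearMap.single E (fun j => Matrix (Fin (d j)) (Fin (d j)) E) i) hone
      (fun x y => by
        change ψ (Pi.single i (x * y)) = ψ (Pi.single i x) * ψ (Pi.single i y)
        rw [Pi.single_mul, map_mul])
  have hθ : Function.Bijective θ := by
    refine ⟨θ.toRingHom.injective, fun y => ?_⟩
    obtain ⟨x, rfl⟩ := hψ y
    exact ⟨x i, (hmul x).symm⟩
  obtain ⟨T, T', h₁, h₂, h⟩ := exists_conj_of_bijective θ hθ
  exact ⟨i, T, T', h₁, h₂, fun x => (hmul x).trans (h (x i))⟩

end Representations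

/-! ### Galois descent -/

section Descent

variable {K E A : Type*} [Field K] [Field E] [Algebra K E] [Ring A] [Algebra K A]

/-- The extension of a representation to scalars. -/
noncomputable def extendRep {n : ℕ} (ρ : A →ₐ[K] Matrix (Fin n) (Fin n) E) :
    E ⊗[K] A →ₐ[E] Matrix (Fin n) (Fin n) E :=
  Algebra.TensorProduct.lift (Algebra.ofId E _) ρ fun x _ => by
    rw [Algebra.ofId_apply]
    exact Algebra.commute_algebraMap_left x _

theorem extendRep_tmul {n : ℕ} (ρ : A →ₐ[K] Matrix (Fin n) (Fin n) E) (e : E) (a : A) :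
    extendRep ρ (e ⊗ₜ a) = e • ρ a := by
  rw [extendRep, Algebra.TensorProduct.lift_tmul, Algebra.ofId_apply, ← Algebra.smul_def]

theorem extendRep_surjective {n : ℕ} (ρ : A →ₐ[K] Matrix (Fin n) (Fin n) E)
    (hρ : Submodule.span E (Set.range ρ) = ⊤) : Function.Surjective (extendRep ρ) := by
  rw [← AlgHom.coe_toLinearMap, ← LinearMap.range_eq_top, eq_top_iff, ← hρ, Submodule.span_le]
  rintro _ ⟨a, rfl⟩
  exact ⟨1 ⊗ₜ a, by simp [extendRep_tmul]⟩

/-- Elements of `E ⊗ A` fixed by the Galois group come from `A`. -/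
theorem exists_one_tmul_of_fixed [IsGalois K E] (z : E ⊗[K] A)
    (hz : ∀ σ : E ≃ₐ[K] E, LinearMap.rTensor A σ.toLinearMap z = z) : ∃ a : A, z = 1 ⊗ₜ a := by
  -- In coordinates for a `K`-basis of `A` the Galois group acts on each coordinate separately.
  let b := Module.Basis.ofVectorSpace K A
  let B := Algebra.TensorProduct.basis E b
  have hrepr : ∀ (σ : E ≃ₐ[K] E) (z : E ⊗[K] A) j,
      B.repr (LinearMap.rTensor A σ.toLinearMap z) j = σ (B.repr z j) := by
    intro σ z j
    induction z with
    | zero => simp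
    | tmul e a =>
      simp [B, Algebra.TensorProduct.basis_repr_tmul]
    | add x y hx hy => simp only [map_add, Finsupp.add_apply, hx, hy]
  have hfix : ∀ j, ∃ k : K, algebraMap K E k = B.repr z j := by
    intro j
    refine (InfiniteGalois.mem_range_algebraMap_iff_fixed _).mpr fun σ => ?_
    rw [← hrepr, hz]
  choose k hk using hfix
  refine ⟨(B.repr z).sum fun j _ => k j • b j, ?_⟩
  conv_lhs => rw [← B.linearCombination_repr z, Finsupp.linearCombination_apply]
  rw [Finsupp.sum, Finsupp.sum, TensorProduct.tmul_sum]
  refine Finset.sum_congr rfl fun j _ => ?_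
  rw [← hk, Algebra.TensorProduct.basis_apply, TensorProduct.tmul_smul, algebraMap_smul]

end Descent

/-! ### Existence and rules of the reduced norm -/

section ReducedNorm

/-- An isomorphism of `E ⊗ A` with a product of matrix algebras over `E`. -/
structure Splitting (K E A : Type*) [Field K] [Field E] [Algebra K E] [Ring A] [Algebra K A] where
  /-- The number of factors. -/
  r : ℕ
  /-- The sizes of the factors. -/
  d : Fin r → ℕ
  pos : ∀ i, NeZero (d i)
  /-- The isomorphism. -/
  equiv : E ⊗[K] A ≃ₐ[E] Π i, Matrix (Fin (d i)) (Fin (d i)) E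

/-- The condition defining the reduced norm, over an arbitrary extension field. -/
def IsReducedNormOver {K : Type*} (E : Type*) {A : Type*} [Field K] [Field E] [Algebra K E]
    [Ring A] [Algebra K A] {ι : Type} [Fintype ι] [DecidableEq ι] (H : Matrix ι ι A)
    (c : Subalgebra.center K A) : Prop :=
  ∀ (n : ℕ) (ρ : A →ₐ[K] Matrix (Fin n) (Fin n) E), Submodule.span E (Set.range ρ) = ⊤ →
    ρ (c : A) = Matrix.scalar (Fin n) (matDet (ρ : A →+* Matrix (Fin n) (Fin n) E) H)

namespace Splitting

variable {K E A : Type*} [Field K] [Field E] [Algebra K E] [Ring A] [Algebra K A]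
  (D : Splitting K E A)

/-- The absolutely irreducible representations given by a splitting. -/
noncomputable def rep (i : Fin D.r) : A →ₐ[K] Matrix (Fin (D.d i)) (Fin (D.d i)) E :=
  (((Pi.evalAlgHom E (fun i => Matrix (Fin (D.d i)) (Fin (D.d i)) E) i).comp
    D.equiv.toAlgHom).restrictScalars K).comp Algebra.TensorProduct.includeRight

theorem equiv_tmul (i : Fin D.r) (e : E) (a : A) : D.equiv (e ⊗ₜ a) i = e • D.rep i a := by
  have : e ⊗ₜ[K] a = e • (1 : E) ⊗ₜ[K] a := by rw [TensorProduct.smul_tmul', smul_eq_mul, mul_one]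
  rw [this, map_smul]
  rfl

theorem rep_injective {a b : A} (h : ∀ i, D.rep i a = D.rep i b) : a = b := by
  apply Algebra.TensorProduct.includeRight_injective (R := K) (A := E) (B := A)
    (algebraMap K E).injective
  apply D.equiv.injective
  ext i : 1
  exact h i

theorem span_range_rep (i : Fin D.r) : Submodule.span E (Set.range (D.rep i)) = ⊤ := by
  rw [eq_top_iff]
  rintro x -
  obtain ⟨z, hz⟩ := D.equiv.surjective (Pi.single i x)
  have hx : D.equiv z i = x := by rw [hz, Pi.single_eq_same]
  rw [← hx]
  clear hz hx
  induction z with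
  | zero => rw [map_zero]; exact zero_mem _
  | tmul e a =>
    rw [equiv_tmul]
    exact Submodule.smul_mem _ _ (Submodule.subset_span ⟨a, rfl⟩)
  | add x y hx hy => rw [map_add]; exact add_mem hx hy

/-- Every absolutely irreducible representation is conjugate to one given by the splitting. -/
theorem exists_conj {n : ℕ} [NeZero n] (ρ : A →ₐ[K] Matrix (Fin n) (Fin n) E)
    (hρ : Submodule.span E (Set.range ρ) = ⊤) :
    ∃ (i : Fin D.r) (T : Matrix (Fin n) (Fin (D.d i)) E) (T' : Matrix (Fin (D.d i)) (Fin n) E),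
      T * T' = 1 ∧ T' * T = 1 ∧ (∀ z, extendRep ρ z = T * D.equiv z i * T') ∧
        ∀ a, ρ a = T * D.rep i a * T' := by
  have := D.pos
  obtain ⟨i, T, T', h₁, h₂, h⟩ := exists_conj_of_surjective
    ((extendRep ρ).comp D.equiv.symm.toAlgHom)
    ((extendRep_surjective ρ hρ).comp D.equiv.symm.surjective)
  have h' : ∀ z, extendRep ρ z = T * D.equiv z i * T' := fun z => by
    rw [← h]
    simp
  refine ⟨i, T, T', h₁, h₂, h', fun a => ?_⟩
  have := h' (1 ⊗ₜ a)
  rwa [extendRep_tmul, one_smul, equiv_tmul, one_smul] at this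

variable {ι : Type} [Fintype ι] [DecidableEq ι]

theorem conj_scalar {m n : ℕ} (T : Matrix (Fin n) (Fin m) E) (T' : Matrix (Fin m) (Fin n) E)
    (h : T * T' = 1) (c : E) :
    T * Matrix.scalar (Fin m) c * T' = Matrix.scalar (Fin n) c := by
  rw [Matrix.scalar_apply, Matrix.scalar_apply, ← Matrix.smul_one_eq_diagonal,
    ← Matrix.smul_one_eq_diagonal, Matrix.mul_smul, Matrix.mul_one, Matrix.smul_mul, h]

/-- Conjugation changes neither scalar matrices nor determinants, so the finitely many
representations of the splitting suffice. -/
theorem isReducedNormOver_iff (H : Matrix ι ι A) (c : Subalgebra.center K A) :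
    IsReducedNormOver E H c ↔ ∀ i, D.rep i (c : A) = Matrix.scalar (Fin (D.d i))
      (matDet (D.rep i : A →+* Matrix (Fin (D.d i)) (Fin (D.d i)) E) H) := by
  refine ⟨fun h i => h _ _ (D.span_range_rep i), fun h n ρ hρ => ?_⟩
  rcases Nat.eq_zero_or_pos n with rfl | hn
  · exact Subsingleton.elim _ _
  have : NeZero n := ⟨hn.ne'⟩
  obtain ⟨i, T, T', h₁, h₂, -, hT⟩ := D.exists_conj ρ hρ
  rw [matDet_conj (D.rep i : A →+* Matrix (Fin (D.d i)) (Fin (D.d i)) E)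
    (ρ : A →+* Matrix (Fin n) (Fin n) E) T T' h₁ h₂ hT, hT, h, conj_scalar T T' h₁]

/-- The reduced norm exists. -/
theorem exists_isReducedNormOver (D : Splitting K E A) [IsGalois K E] (H : Matrix ι ι A) :
    ∃ c, IsReducedNormOver (K := K) E H c := by
  have := D.pos
  let N : Fin D.r → E := fun i =>
    matDet (D.rep i : A →+* Matrix (Fin (D.d i)) (Fin (D.d i)) E) H
  let z : E ⊗[K] A := D.equiv.symm fun i => Matrix.scalar _ (N i)
  have hz : ∀ i, D.equiv z i = Matrix.scalar _ (N i) := fun i => by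
    rw [AlgEquiv.apply_symm_apply]
  -- Twisting representation `i` by `σ⁻¹` gives one conjugate to some representation `j`. Hence `N j
  -- = σ⁻¹ (N i)`: the Galois group permutes the components of `z` compatibly, and `z` is fixed.
  obtain ⟨a, ha⟩ := exists_one_tmul_of_fixed z fun σ => by
    apply D.equiv.injective
    ext i : 1
    let ρ : A →ₐ[K] Matrix (Fin (D.d i)) (Fin (D.d i)) E :=
      (σ.symm : E →ₐ[K] E).mapMatrix.comp (D.rep i)
    have hσρ : ∀ z, D.equiv (LinearMap.rTensor A σ.toLinearMap z) i = (extendRep ρ z).map σ := by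
      intro z
      induction z with
      | zero => simp
      | tmul e a =>
        rw [LinearMap.rTensor_tmul, equiv_tmul, extendRep_tmul]
        ext s t
        simp [ρ]
      | add x y hx hy =>
        rw [map_add, map_add, map_add, Pi.add_apply, hx, hy, Matrix.map_add _ (map_add σ)]
    have hρ : Submodule.span E (Set.range ρ) = ⊤ := by
      rw [eq_top_iff]
      rintro x -
      have hx : x.map σ ∈ Submodule.span E (Set.range (D.rep i)) := by
        rw [D.span_range_rep]; trivial
      have key : ∀ y ∈ Submodule.span E (Set.range (D.rep i)),
          y.map σ.symm ∈ Submodule.span E (Set.range ρ) := by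
        intro y hy
        induction hy using Submodule.span_induction with
        | mem y hy =>
          obtain ⟨a, rfl⟩ := hy
          exact Submodule.subset_span ⟨a, rfl⟩
        | zero => rw [Matrix.map_zero _ (map_zero σ.symm)]; exact zero_mem _
        | add y y' _ _ hy hy' => rw [Matrix.map_add _ (map_add σ.symm)]; exact add_mem hy hy'
        | smul e y _ hy =>
          rw [show (e • y).map σ.symm = σ.symm e • y.map σ.symm by ext; simp]
          exact Submodule.smul_mem _ _ hy
      have := key _ hx
      rwa [Matrix.map_map, show (⇑σ.symm ∘ ⇑σ) = id from funext σ.symm_apply_apply,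
        Matrix.map_id] at this
    obtain ⟨j, T, T', h₁, h₂, hT, hT'⟩ := D.exists_conj ρ hρ
    have hN : N j = σ.symm (N i) := by
      refine (matDet_conj (D.rep j : A →+* Matrix (Fin (D.d j)) (Fin (D.d j)) E)
        (ρ : A →+* Matrix (Fin (D.d i)) (Fin (D.d i)) E) T T' h₁ h₂ hT' H).symm.trans ?_
      exact matDet_map (D.rep i : A →+* Matrix (Fin (D.d i)) (Fin (D.d i)) E)
        (σ.symm : E →+* E) H
    rw [hσρ, hT, hz, hz, conj_scalar T T' h₁, hN]
    ext s t
    by_cases hst : s = t <;> simp [hst]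
  have hrep : ∀ i, D.rep i a = Matrix.scalar _ (N i) := fun i => by
    rw [← hz, ha, equiv_tmul, one_smul]
  have hcen : a ∈ Subalgebra.center K A := Subalgebra.mem_center_iff.mpr fun b =>
    D.rep_injective fun i => by
      rw [map_mul, map_mul, hrep]
      exact (Matrix.scalar_commute _ (fun _ => Commute.all _ _) _).symm
  exact ⟨⟨a, hcen⟩, (D.isReducedNormOver_iff H _).mpr hrep⟩

end Splitting

theorem IsSeparableAlgebra.nonempty_splitting {K : Type v} {A : Type w} [Field K] [Ring A]
    [Algebra K A] (hA : IsSeparableAlgebra K A) (E : Type v) [Field E] [Algebra K E]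
    [IsSepClosed E] : Nonempty (Splitting K E A) := by
  obtain ⟨r, d, hd, ⟨Φ⟩⟩ := hA.exists_algEquiv_pi_matrix E
  exact ⟨⟨r, d, hd, Φ⟩⟩

section

variable {K A : Type*} [Field K] [Ring A] [Algebra K A] (D : Splitting K (SeparableClosure K) A)
  {ι κ : Type} [Fintype ι] [DecidableEq ι] [Fintype κ] [DecidableEq κ]

include D

theorem rep_nr (H : Matrix ι ι A) (i : Fin D.r) :
    D.rep i (nr K H : A) = Matrix.scalar (Fin (D.d i))
      (matDet (D.rep i : A →+* Matrix (Fin (D.d i)) (Fin (D.d i)) (SeparableClosure K)) H) := by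
  have hex : ∃ c, IsReducedNorm K H c := D.exists_isReducedNormOver H
  rw [nr, dif_pos hex]
  exact (D.isReducedNormOver_iff H _).mp hex.choose_spec i

/-- The representations jointly separate points of `A`, so identities of reduced norms reduce to
identities of determinants. -/
theorem nr_eq_of_rep {H : Matrix ι ι A} {c : Subalgebra.center K A}
    (h : ∀ i, D.rep i (c : A) = Matrix.scalar (Fin (D.d i))
      (matDet (D.rep i : A →+* Matrix (Fin (D.d i)) (Fin (D.d i)) (SeparableClosure K)) H)) :
    nr K H = c :=
  Subtype.ext (D.rep_injective fun i => by rw [rep_nr D, h])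

theorem nr_one : nr K (1 : Matrix ι ι A) = 1 :=
  nr_eq_of_rep D fun i => by rw [matDet_one, map_one]; exact map_one _

theorem nr_mul (H₁ H₂ : Matrix ι ι A) : nr K (H₁ * H₂) = nr K H₁ * nr K H₂ :=
  nr_eq_of_rep D fun i => by
    rw [matDet_mul, map_mul, MulMemClass.coe_mul, map_mul, rep_nr D, rep_nr D]

theorem nr_submatrix_equiv (e : κ ≃ ι) (H : Matrix ι ι A) : nr K (H.submatrix e e) = nr K H :=
  nr_eq_of_rep D fun i => by rw [matDet_submatrix_equiv, rep_nr D]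

theorem nr_fromBlocks_zero₁₂ (H₁ : Matrix ι ι A) (C : Matrix κ ι A) (H₂ : Matrix κ κ A) :
    nr K (Matrix.fromBlocks H₁ 0 C H₂) = nr K H₁ * nr K H₂ :=
  nr_eq_of_rep D fun i => by
    rw [matDet_fromBlocks_zero₁₂, map_mul, MulMemClass.coe_mul, map_mul, rep_nr D, rep_nr D]

end

end ReducedNorm

/-! ### The ring `𝓘(R)` is noetherian -/

section NormRing

/-- The algebra generated by a multiplicative monoid is its linear span, which `f` embeds into the
noetherian module `T`. -/
theorem finite_adjoin_of_injective {Λ C P : Type*} [CommRing Λ] [IsNoetherianRing Λ] [CommRing C]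
    [Algebra Λ C] [AddCommGroup P] [Module Λ P] (N : Submonoid C) (f : C →ₗ[Λ] P)
    (hf : Function.Injective f) (T : Submodule Λ P) (hT : T.FG) (h : ∀ z ∈ N, f z ∈ T) :
    Module.Finite Λ (Algebra.adjoin Λ (N : Set C)) := by
  have hle : Subalgebra.toSubmodule (Algebra.adjoin Λ (N : Set C)) ≤ T.comap f := by
    rw [Algebra.adjoin_eq_span, Submonoid.closure_eq, Submodule.span_le]
    exact h
  have : IsNoetherian Λ T := isNoetherian_of_fg_of_noetherian T hT
  let g : Subalgebra.toSubmodule (Algebra.adjoin Λ (N : Set C)) →ₗ[Λ] T :=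
    (f ∘ₗ Submodule.subtype _).codRestrict T fun c => hle c.2
  have hg : Function.Injective g := fun x y h => Subtype.ext (hf (congrArg Subtype.val h))
  exact Module.Finite.of_injective g hg

variable {Λ : Type u} {K : Type v} {A : Type w} [CommRing Λ] [Field K] [Ring A] [Algebra K A]
  [Algebra Λ A] (R : Subalgebra Λ A)

theorem map_coe_mul {ι κ μ : Type*} [Fintype κ] (H₁ : Matrix ι κ R) (H₂ : Matrix κ μ R) :
    (H₁ * H₂).map (fun r : R => (r : A)) =
      H₁.map (fun r : R => (r : A)) * H₂.map fun r : R => (r : A) :=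
  Matrix.map_mul (f := (R.val : R →+* A))

theorem map_coe_one {ι : Type*} [DecidableEq ι] :
    (1 : Matrix ι ι R).map (fun r : R => (r : A)) = 1 :=
  Matrix.map_one _ rfl rfl

variable (D : Splitting K (SeparableClosure K) A)
  {ι κ : Type} [Fintype ι] [DecidableEq ι] [Fintype κ] [DecidableEq κ]

include D

theorem nrR_one : nrR K R (1 : Matrix ι ι R) = 1 := by
  rw [nrR, map_coe_one, nr_one D]

theorem nrR_mul (H₁ H₂ : Matrix ι ι R) : nrR K R (H₁ * H₂) = nrR K R H₁ * nrR K R H₂ := by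
  rw [nrR, map_coe_mul, nr_mul D, nrR, nrR]

theorem nrR_submatrix_equiv (e : κ ≃ ι) (H : Matrix ι ι R) :
    nrR K R (H.submatrix e e) = nrR K R H := by
  rw [nrR, ← Matrix.submatrix_map, nr_submatrix_equiv D, nrR]

theorem nrR_fromBlocks_zero₁₂ (H₁ : Matrix ι ι R) (C : Matrix κ ι R) (H₂ : Matrix κ κ R) :
    nrR K R (Matrix.fromBlocks H₁ 0 C H₂) = nrR K R H₁ * nrR K R H₂ := by
  rw [nrR, Matrix.fromBlocks_map, Matrix.map_zero _ rfl, nr_fromBlocks_zero₁₂ D, nrR, nrR]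

theorem nrR_mem (H : Matrix ι ι R) : nrR K R H ∈ normRing K R := by
  rw [← nrR_submatrix_equiv R D (Fintype.equivFin ι).symm]
  exact Subring.subset_closure (Or.inr ⟨_, _, rfl⟩)

variable [Algebra Λ K] [IsScalarTower Λ K A]

/-- The reduced norms of all matrices over an order lie in a finite algebra. -/
theorem exists_finite_subalgebra_nrR_mem [IsNoetherianRing Λ] [Module.Finite Λ R] :
    ∃ W : Subalgebra Λ (Subalgebra.center K A), Module.Finite Λ W ∧
      ∀ (a : ℕ) (H : Matrix (Fin a) (Fin a) R), nrR K R H ∈ W := by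
  let E := SeparableClosure K
  let M : Fin D.r → Type v := fun i => Matrix (Fin (D.d i)) (Fin (D.d i)) E
  have : IsScalarTower Λ K E := inferInstance
  let p : ∀ i, R →ₐ[Λ] M i := fun i => ((D.rep i).restrictScalars Λ).comp R.val
  have hW : ∀ i, ∃ W : Submodule Λ E, W.FG ∧ ∀ (a : ℕ) (H : Matrix (Fin a) (Fin a) R),
      matDet (p i : R →+* M i) H ∈ W := fun i => exists_fg_matDet_mem (p i)
  choose W hWfg hWmem using hW
  -- The empty matrix has norm `1`, and block-diagonal matrices give products.
  let N : Submonoid (Subalgebra.center K A) :=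
    { carrier := {z | ∃ (a : ℕ) (H : Matrix (Fin a) (Fin a) R), nrR K R H = z}
      one_mem' := ⟨0, 1, nrR_one R D⟩
      mul_mem' := by
        rintro _ _ ⟨a, H, rfl⟩ ⟨b, H', rfl⟩
        refine ⟨a + b, (Matrix.fromBlocks H 0 0 H').submatrix finSumFinEquiv.symm
          finSumFinEquiv.symm, ?_⟩
        rw [nrR_submatrix_equiv R D, nrR_fromBlocks_zero₁₂ R D] }
  let f : Subalgebra.center K A →ₗ[Λ] Π i, M i := LinearMap.pi fun i =>
    ((D.rep i).restrictScalars Λ).toLinearMap ∘ₗ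
      ((Subalgebra.center K A).val.restrictScalars Λ).toLinearMap
  have hf : Function.Injective f := fun x y h =>
    Subtype.ext (D.rep_injective fun i => congrFun h i)
  let sc : ∀ i, E →ₗ[Λ] M i := fun i =>
    (Algebra.ofId E (M i)).toLinearMap.restrictScalars Λ
  refine ⟨Algebra.adjoin Λ N, finite_adjoin_of_injective N f hf
    (Submodule.pi Set.univ fun i => (W i).map (sc i))
    (Submodule.fg_pi fun i => (hWfg i).map (sc i)) ?_,
    fun a H => Algebra.subset_adjoin ⟨a, H, rfl⟩⟩
  rintro _ ⟨a, H, rfl⟩ i -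
  exact ⟨_, hWmem i a H, (rep_nr D _ i).symm⟩

omit D in
theorem exists_finite_subalgebra_center [IsNoetherianRing Λ] [Module.Finite Λ R] :
    ∃ W : Subalgebra Λ (Subalgebra.center K A), Module.Finite Λ W ∧
      {z : Subalgebra.center K A | ∃ r ∈ Subring.center R, (r : A) = z} ⊆ W := by
  let W : Subalgebra Λ (Subalgebra.center K A) :=
    R.comap ((Subalgebra.center K A).val.restrictScalars Λ)
  refine ⟨W, ?_, ?_⟩
  · let g : W →ₐ[Λ] R := (((Subalgebra.center K A).val.restrictScalars Λ).comp W.val).codRestrict R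
      fun c => c.2
    have hg : Function.Injective g := fun x y h => by
      have h' : (g x : A) = g y := by rw [h]
      exact Subtype.ext (Subtype.ext h')
    exact Module.Finite.of_injective g.toLinearMap hg
  · rintro z ⟨r, -, hr⟩
    change (z : A) ∈ R
    rw [← hr]
    exact r.2

/-- `𝓘(R)` lies in the compositum of two finite commutative `Λ`-algebras, one containing the norms
and one the central elements of `R`. -/
theorem isNoetherianRing_normRing [IsNoetherianRing Λ] [Module.Finite Λ R] :
    IsNoetherianRing (normRing K R) := by
  obtain ⟨W₁, _, h₁⟩ := exists_finite_subalgebra_nrR_mem R D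
  obtain ⟨W₂, _, h₂⟩ := exists_finite_subalgebra_center (K := K) R
  let I : Subalgebra Λ (Subalgebra.center K A) :=
    { (normRing K R).toSubsemiring with
      algebraMap_mem' := fun l => Subring.subset_closure (Or.inl ⟨algebraMap Λ R l,
        Subring.mem_center_iff.mpr fun g => (Algebra.commutes l g).symm, rfl⟩) }
  have hle : I ≤ W₁ ⊔ W₂ := by
    have : normRing K R ≤ (W₁ ⊔ W₂).toSubring := by
      refine (Subring.closure_le).mpr ?_
      rintro z (hz | ⟨a, H, rfl⟩)
      · exact (le_sup_right : W₂ ≤ W₁ ⊔ W₂) (h₂ hz)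
      · exact (le_sup_left : W₁ ≤ W₁ ⊔ W₂) (h₁ a H)
    exact this
  have : Module.Finite Λ ↥(W₁ ⊔ W₂) := Subalgebra.finite_sup W₁ W₂
  have : Module.Finite Λ I := Module.Finite.of_injective
    (Subalgebra.inclusion hle).toLinearMap (Subalgebra.inclusion_injective hle)
  have : IsNoetherianRing I := IsNoetherianRing.of_finite Λ I
  exact this

end NormRing

/-! ### Presentations by matrices acting on row vectors -/

section Presentations

variable {R : Type*} [Ring R] {M M' P : Type*} [AddCommGroup M] [Module R M] [AddCommGroup M']
  [Module R M'] [AddCommGroup P] [Module R P]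
  {α β γ δ : Type*}

/-- `k` and `g` form a presentation: `g` is surjective and the rows of `k` generate its kernel. -/
structure IsPresentation [Fintype β] (k : Matrix β α R) (g : (α → R) →ₗ[R] M) : Prop where
  surjective : Function.Surjective g
  exact : ∀ x, g x = 0 ↔ ∃ y, Matrix.vecMul y k = x

theorem IsPresentation.apply_vecMul [Fintype β] {k : Matrix β α R} {g : (α → R) →ₗ[R] M}
    (h : IsPresentation k g) (y : β → R) : g (Matrix.vecMul y k) = 0 :=
  (h.exact _).mpr ⟨y, rfl⟩

theorem IsPresentation.apply_row [Fintype β] {k : Matrix β α R} {g : (α → R) →ₗ[R] M}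
    (h : IsPresentation k g) (b : β) : g (k b) = 0 := by
  classical
  rw [show k b = Matrix.vecMul (Pi.single b 1) k by rw [Matrix.single_one_vecMul]; rfl]
  exact h.apply_vecMul _

theorem vecMul_submatrix_equiv [Fintype β] [Fintype δ] (k : Matrix β α R) (e : δ ≃ β)
    (f : γ → α) (y : β → R) :
    Matrix.vecMul (y ∘ e) (k.submatrix e f) = Matrix.vecMul y k ∘ f := by
  ext j
  simp only [Matrix.vecMul, dotProduct, Function.comp, Matrix.submatrix_apply]
  exact e.sum_comp fun b => y b * k b (f j)

theorem IsPresentation.submatrix_equiv [Fintype β] [Fintype δ] {k : Matrix β α R}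
    {g : (α → R) →ₗ[R] M}
    (h : IsPresentation k g) (e : δ ≃ β) (f : γ ≃ α) :
    IsPresentation (k.submatrix e f) (g ∘ₗ LinearMap.funLeft R R f.symm) where
  surjective := h.surjective.comp (LinearMap.funLeft_surjective_of_injective R R _ f.symm.injective)
  exact x := by
    rw [LinearMap.comp_apply, h.exact]
    constructor
    · rintro ⟨y, hy⟩
      refine ⟨y ∘ e, ?_⟩
      rw [vecMul_submatrix_equiv, hy]
      ext j
      simp [LinearMap.funLeft_apply]
    · rintro ⟨y, rfl⟩
      refine ⟨y ∘ e.symm, ?_⟩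
      have := vecMul_submatrix_equiv k e f (y ∘ e.symm)
      rw [show (y ∘ e.symm) ∘ e = y by ext; simp] at this
      rw [this]
      ext j
      simp [LinearMap.funLeft_apply]

theorem IsPresentation.fromRows [Fintype β] [Fintype γ] {k : Matrix β α R} {l : Matrix γ α R}
    {g : (α → R) →ₗ[R] M}
    (hk : IsPresentation k g) (hl : IsPresentation l g) :
    IsPresentation (Matrix.fromRows k l) g where
  surjective := hk.surjective
  exact x := by
    constructor
    · intro hx
      obtain ⟨y, rfl⟩ := (hk.exact x).mp hx
      exact ⟨Sum.elim y 0, by rw [Matrix.sumElim_vecMul_fromRows, Matrix.zero_vecMul, add_zero]⟩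
    · rintro ⟨y, rfl⟩
      rw [Matrix.vecMul_fromRows, map_add, hk.apply_vecMul, hl.apply_vecMul, add_zero]

/-- The homomorphism on a direct sum of free modules given by its components. -/
def coprodPi (f : (α → R) →ₗ[R] M) (g : (β → R) →ₗ[R] M) : (α ⊕ β → R) →ₗ[R] M :=
  f ∘ₗ LinearMap.funLeft R R Sum.inl + g ∘ₗ LinearMap.funLeft R R Sum.inr

theorem coprodPi_apply (f : (α → R) →ₗ[R] M) (g : (β → R) →ₗ[R] M) (x : α ⊕ β → R) :
    coprodPi f g x = f (x ∘ Sum.inl) + g (x ∘ Sum.inr) := rfl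

/-- The horseshoe lemma for presentations. -/
theorem IsPresentation.exists_fromBlocks [Fintype β] {α' β' : Type*} [Fintype β']
    {k' : Matrix β' α' R}
    {g' : (α' → R) →ₗ[R] M'} (hk' : IsPresentation k' g') {H : Matrix β α R}
    {gP : (α → R) →ₗ[R] P} (hH : IsPresentation H gP) (i : M' →ₗ[R] M) (q : M →ₗ[R] P)
    (hi : Function.Injective i) (hiq : Function.Exact i q)
    (y : (α → R) →ₗ[R] M) (hy : ∀ x, q (y x) = gP x) :
    ∃ C : Matrix β α' R, IsPresentation (Matrix.fromBlocks k' 0 C H) (coprodPi (i ∘ₗ g') y) := by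
  -- A relation of `P`, lifted to `M`, gives an element of `M'`; the block `C` records its negative
  -- in terms of the generators of `M'`.
  have hrow : ∀ b, ∃ c : α' → R, i (g' c) = y (H b) := by
    intro b
    obtain ⟨m, hm⟩ := (hiq (y (H b))).mp (by rw [hy, hH.apply_row])
    obtain ⟨c, rfl⟩ := hk'.surjective m
    exact ⟨c, hm⟩
  choose c hc using hrow
  let C : Matrix β α' R := Matrix.of fun b => -c b
  have hC : ∀ z : β → R, i (g' (Matrix.vecMul z C)) + y (Matrix.vecMul z H) = 0 := by
    intro z
    rw [Matrix.vecMul_eq_sum, Matrix.vecMul_eq_sum, map_sum, map_sum, map_sum,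
      ← Finset.sum_add_distrib]
    refine Finset.sum_eq_zero fun b _ => ?_
    change i (g' (z b • -c b)) + y (z b • H b) = 0
    rw [map_smul, map_smul, map_smul, map_neg, map_neg, hc, ← smul_add, neg_add_cancel, smul_zero]
  refine ⟨C, ⟨fun m => ?_, fun x => ⟨fun hx => ?_, ?_⟩⟩⟩
  · obtain ⟨v, hv⟩ := hH.surjective (q m)
    obtain ⟨m', hm'⟩ := (hiq (m - y v)).mp (by rw [map_sub, hy, hv, sub_self])
    obtain ⟨u, rfl⟩ := hk'.surjective m'
    refine ⟨Sum.elim u v, ?_⟩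
    rw [coprodPi_apply, Sum.elim_comp_inl, Sum.elim_comp_inr, LinearMap.comp_apply, hm',
      sub_add_cancel]
  · rw [coprodPi_apply, LinearMap.comp_apply] at hx
    have h1 : gP (x ∘ Sum.inr) = 0 := by
      have := congrArg q hx
      rwa [map_add, hiq.apply_apply_eq_zero, zero_add, hy, map_zero] at this
    obtain ⟨z, hz⟩ := (hH.exact _).mp h1
    have h2 : g' (x ∘ Sum.inl - Matrix.vecMul z C) = 0 := by
      apply hi
      have := hC z
      rw [hz] at this
      rw [map_sub, map_sub, map_zero, sub_eq_zero]
      exact (add_right_cancel (hx.trans this.symm))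
    obtain ⟨t, ht⟩ := (hk'.exact _).mp h2
    refine ⟨Sum.elim t z, ?_⟩
    rw [Matrix.vecMul_fromBlocks, Sum.elim_comp_inl, Sum.elim_comp_inr, ht, hz, Matrix.vecMul_zero,
      sub_add_cancel, zero_add, Sum.elim_comp_inl_inr]
  · rintro ⟨z, rfl⟩
    rw [Matrix.vecMul_fromBlocks, coprodPi_apply, Sum.elim_comp_inl, Sum.elim_comp_inr,
      LinearMap.comp_apply, Matrix.vecMul_zero, zero_add, map_add, map_add, hk'.apply_vecMul,
      map_zero, zero_add, hC]

/-- A presentation stays one after adding superfluous generators. -/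
theorem IsPresentation.exists_fromBlocks_one [Fintype β] [Fintype γ] {k : Matrix β α R}
    {g : (α → R) →ₗ[R] M} (hk : IsPresentation k g) [DecidableEq γ] (y : (γ → R) →ₗ[R] M) :
    ∃ C : Matrix γ α R, IsPresentation (Matrix.fromBlocks k 0 C 1) (coprodPi g y) :=
  -- The horseshoe with zero quotient, presented by the identity matrix.
  hk.exists_fromBlocks (P := PUnit.{1}) (H := (1 : Matrix γ γ R)) (gP := 0)
    ⟨fun _ => ⟨0, rfl⟩, fun x => ⟨fun _ => ⟨x, Matrix.vecMul_one x⟩, fun _ => rfl⟩⟩ LinearMap.id 0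
    Function.injective_id (fun x => ⟨fun _ => ⟨x, rfl⟩, fun _ => rfl⟩) y fun _ => rfl

/-- If `H` presents a quotient `P` of `M` on the same generators and has independent rows, every
presentation of `M` is the product with `H` of a presentation of the kernel `M'`. -/
theorem IsPresentation.exists_eq_mul [Fintype α] [Fintype β] {k : Matrix β α R}
    {g : (α → R) →ₗ[R] M}
    (hk : IsPresentation k g) (i : M' →ₗ[R] M) (q : M →ₗ[R] P) (hi : Function.Injective i)
    (hiq : Function.Exact i q) {H : Matrix α α R} (hH : IsPresentation H (q ∘ₗ g))
    (hinj : ∀ x, Matrix.vecMul x H = 0 → x = 0) :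
    ∃ (k' : Matrix β α R) (g' : (α → R) →ₗ[R] M'), k = k' * H ∧ IsPresentation k' g' := by
  -- Relations of `M` are relations of `P`, hence combinations of the rows of `H`.
  have hrow : ∀ b, ∃ c, Matrix.vecMul c H = k b := fun b =>
    (hH.exact _).mp (by rw [LinearMap.comp_apply, hk.apply_row, map_zero])
  choose c hc using hrow
  let k' : Matrix β α R := Matrix.of c
  have hkk : k = k' * H := by
    ext b j
    exact (congrFun (hc b) j).symm
  -- The rows of `H` are sent by `g` into `ker q = M'`; these images serve as the generators of
  -- `M'`.
  have hmem : ∀ x, ∃ m, i m = (g ∘ₗ H.vecMulLinear) x := fun x => (hiq _).mp (hH.apply_vecMul x)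
  let e := LinearEquiv.ofInjective i hi
  let g' : (α → R) →ₗ[R] M' := e.symm.toLinearMap ∘ₗ
    (g ∘ₗ H.vecMulLinear).codRestrict (LinearMap.range i) hmem
  have hg' : ∀ x, i (g' x) = g (Matrix.vecMul x H) := fun x => by
    change (e (e.symm _) : M) = _
    rw [LinearEquiv.apply_symm_apply]
    rfl
  refine ⟨k', g', hkk, fun m => ?_, fun x => ?_⟩
  · obtain ⟨w, hw⟩ := hk.surjective (i m)
    obtain ⟨x, rfl⟩ := (hH.exact w).mp (by
      rw [LinearMap.comp_apply, hw, hiq.apply_apply_eq_zero])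
    exact ⟨x, hi (by rw [hg', hw])⟩
  · rw [← map_eq_zero_iff i hi, hg', hk.exact]
    refine exists_congr fun y => ?_
    rw [hkk, ← Matrix.vecMul_vecMul]
    constructor
    · intro h
      rw [← sub_eq_zero]
      exact hinj _ (by rw [Matrix.sub_vecMul, h, sub_self])
    · intro h
      rw [h]

theorem exists_isPresentation [IsNoetherianRing R] [Module.Finite R M] :
    ∃ (a b : ℕ) (k : Matrix (Fin b) (Fin a) R) (g : (Fin a → R) →ₗ[R] M), IsPresentation k g := by
  obtain ⟨a, g, hg⟩ := Module.Finite.exists_fin' R M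
  obtain ⟨b, s, hs⟩ := Submodule.fg_iff_exists_fin_generating_family.mp
    (IsNoetherian.noetherian (LinearMap.ker g))
  refine ⟨a, b, Matrix.of s, g, hg, fun x => ?_⟩
  rw [← LinearMap.mem_ker, ← hs, Submodule.mem_span_range_iff_exists_fun]
  refine exists_congr fun c => ?_
  rw [Matrix.vecMul_eq_sum]
  rfl

end Presentations

/-! ### Fitting ideals of matrices, the largest ideal, multiplicativity -/

section MatrixFitting

variable {Λ : Type u} (K : Type v) {A : Type w} [CommRing Λ] [Field K] [Ring A] [Algebra K A]
  [Algebra Λ A] {R : Subalgebra Λ A}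
  {α β γ δ : Type} [Fintype α] [DecidableEq α]

/-- The ideal generated by the reduced norms of all maximal square matrices formed by rows of
`k`. -/
noncomputable def matrixFitt (k : Matrix β α R) : Ideal (normRing K R) :=
  Ideal.span {z | ∃ f : α → β, (z : Subalgebra.center K A) = nrR K R (k.submatrix f id)}

theorem matrixFitt_le_fromRows_left (k : Matrix β α R) (l : Matrix δ α R) :
    matrixFitt K k ≤ matrixFitt K (Matrix.fromRows k l) :=
  Ideal.span_mono fun _ ⟨g, hg⟩ => ⟨Sum.inl ∘ g, hg⟩

theorem matrixFitt_le_fromRows_right (k : Matrix β α R) (l : Matrix δ α R) :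
    matrixFitt K l ≤ matrixFitt K (Matrix.fromRows k l) :=
  Ideal.span_mono fun _ ⟨g, hg⟩ => ⟨Sum.inr ∘ g, hg⟩

variable {K} (D : Splitting K (SeparableClosure K) A)

include D

theorem matrixFitt_submatrix_equiv [Fintype γ] [DecidableEq γ] (k : Matrix β α R) (e : δ ≃ β)
    (f : γ ≃ α) :
    matrixFitt K (k.submatrix e f) = matrixFitt K k := by
  refine congrArg Ideal.span (Set.ext fun z => ⟨?_, ?_⟩)
  · rintro ⟨g, hg⟩
    refine ⟨e ∘ g ∘ f.symm, hg.trans ?_⟩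
    rw [← nrR_submatrix_equiv R D f]
    congr 1
    ext i j
    simp
  · rintro ⟨g, hg⟩
    refine ⟨e.symm ∘ g ∘ f, hg.trans ?_⟩
    rw [← nrR_submatrix_equiv R D f]
    congr 1
    ext i j
    simp

/-- The reduced norm of a square matrix over the order, as an element of `𝓘(R)`. -/
noncomputable def normElem (H : Matrix α α R) : normRing K R := ⟨nrR K R H, nrR_mem R D H⟩

/-- Taking all lower rows along with a choice of rows of `k` gives a block-triangular matrix. -/
theorem mul_matrixFitt_le_fromBlocks {α' β' : Type} [Fintype α'] [DecidableEq α']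
    (k : Matrix β' α' R) (C : Matrix α α' R) (H : Matrix α α R) :
    Ideal.span {normElem D H} * matrixFitt K k ≤ matrixFitt K (Matrix.fromBlocks k 0 C H) := by
  rw [matrixFitt, Ideal.span_mul_span', Ideal.span_le]
  rintro _ ⟨_, rfl, z, ⟨f, hz⟩, rfl⟩
  refine Ideal.subset_span ⟨Sum.map f id, ?_⟩
  rw [show (Matrix.fromBlocks k 0 C H).submatrix (Sum.map f id) id =
    Matrix.fromBlocks (k.submatrix f id) 0 C H by ext (i | i) (j | j) <;> rfl,
    nrR_fromBlocks_zero₁₂ R D, ← hz, mul_comm]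
  rfl

theorem matrixFitt_le_fromBlocks_one {α' β' : Type} [Fintype α'] [DecidableEq α']
    (k : Matrix β' α' R) (C : Matrix α α' R) :
    matrixFitt K k ≤ matrixFitt K (Matrix.fromBlocks k 0 C (1 : Matrix α α R)) := by
  have h : normElem D (1 : Matrix α α R) = 1 := Subtype.ext (nrR_one R D)
  have := mul_matrixFitt_le_fromBlocks D k C 1
  rwa [h, Ideal.span_singleton_one, Ideal.top_mul] at this

theorem matrixFitt_mul_le (k : Matrix β α R) (H : Matrix α α R) :
    matrixFitt K (k * H) ≤ Ideal.span {normElem D H} * matrixFitt K k := by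
  rw [matrixFitt, Ideal.span_le]
  rintro z ⟨f, hz⟩
  have h : z = normElem D H * normElem D (k.submatrix f id) := by
    apply Subtype.ext
    rw [hz, show (k * H).submatrix f id = k.submatrix f id * H from rfl, nrR_mul R D, mul_comm]
    rfl
  rw [h]
  exact Ideal.mul_mem_mul (Ideal.mem_span_singleton_self _) (Ideal.subset_span ⟨f, rfl⟩)

theorem nrR_eq_zero_of_row_eq {H : Matrix α α R} {i j : α} (hij : i ≠ j) (h : ∀ k, H i k = H j k) :
    nrR K R H = 0 := by
  refine nr_eq_of_rep D fun t => ?_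
  have := D.pos t
  have h0 : matDet (D.rep t : A →+* Matrix (Fin (D.d t)) (Fin (D.d t)) (SeparableClosure K))
      (H.map fun r : R => (r : A)) = 0 := by
    refine Matrix.det_zero_of_row_eq (i := (i, 0)) (j := (j, 0)) (by simpa using hij) ?_
    ext ⟨k, s⟩
    simp [h]
  rw [h0, map_zero, ZeroMemClass.coe_zero, map_zero]

omit [Fintype α] [DecidableEq α] in
-- An injective choice of rows is an increasing one up to a permutation matrix, whose norm lies in
-- `𝓘(R)`; a repeated row makes the norm zero.
theorem fitt_eq_matrixFitt {a b : ℕ} (h : (Fin b → R) →ₗ[R] (Fin a → R)) :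
    fitt K h = matrixFitt K (LinearMap.toMatrixRight' h) := by
  refine le_antisymm (Ideal.span_mono fun z ⟨s, hs⟩ => ⟨s, hs⟩) ?_
  rw [matrixFitt, Ideal.span_le]
  rintro z ⟨f, hz⟩
  by_cases hf : Function.Injective f
  · let σ := Tuple.sort f
    let s : Fin a ↪o Fin b := OrderEmbedding.ofStrictMono (f ∘ σ)
      ((Tuple.monotone_sort f).strictMono_of_injective (hf.comp σ.injective))
    let T : Matrix (Fin a) (Fin a) R := (1 : Matrix (Fin a) (Fin a) R).submatrix σ.symm id
    have hfac : (LinearMap.toMatrixRight' h).submatrix f id =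
        T * (LinearMap.toMatrixRight' h).submatrix s id := by
      ext i j
      simp [T, s, Matrix.mul_apply, Matrix.one_apply]
    have hz' : z = normElem D T * normElem D ((LinearMap.toMatrixRight' h).submatrix s id) :=
      Subtype.ext (by rw [hz, hfac, nrR_mul R D]; rfl)
    rw [hz']
    exact Ideal.mul_mem_left _ _ (Ideal.subset_span ⟨s, rfl⟩)
  · obtain ⟨i, j, hij, hne⟩ := Function.not_injective_iff.mp hf
    have : z = 0 := Subtype.ext (hz.trans (nrR_eq_zero_of_row_eq D hne fun k => by
      rw [Matrix.submatrix_apply, Matrix.submatrix_apply, hij]))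
    rw [this]
    exact zero_mem _

theorem IsPresentation.matrixFitt_mem [Fintype β] {M : ModuleCat.{w} R} {k : Matrix β α R}
    {g : (α → R) →ₗ[R] M} (h : IsPresentation k g) : matrixFitt K k ∈ fittSet K R M := by
  classical
  let e := (Fintype.equivFin β).symm
  let f := (Fintype.equivFin α).symm
  have h' := h.submatrix_equiv e f
  refine ⟨_, _, (k.submatrix e f).vecMulLinear, _, fun x => ?_, h'.surjective, ?_⟩
  · exact (h'.exact x).trans Iff.rfl
  · rw [fitt_eq_matrixFitt D, ← matrixFitt_submatrix_equiv D k e f]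
    congr 1
    exact (LinearMap.toMatrixRight'.apply_symm_apply _).symm

omit [Fintype α] [DecidableEq α] in
theorem exists_of_mem_fittSet {M : ModuleCat.{w} R} {I : Ideal (normRing K R)}
    (hI : I ∈ fittSet K R M) :
    ∃ (a b : ℕ) (k : Matrix (Fin b) (Fin a) R) (g : (Fin a → R) →ₗ[R] M),
      IsPresentation k g ∧ I = matrixFitt K k := by
  obtain ⟨a, b, h, g, hex, hg, rfl⟩ := hI
  refine ⟨a, b, LinearMap.toMatrixRight' h, g, ⟨hg, fun x => (hex x).trans ?_⟩,
    fitt_eq_matrixFitt D h⟩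
  have : ∀ y, Matrix.vecMul y (LinearMap.toMatrixRight' h) = h y := fun y =>
    LinearMap.congr_fun (LinearMap.toMatrixRight'.symm_apply_apply h) y
  exact exists_congr fun y => by rw [this]

omit [Fintype α] [DecidableEq α] in
-- Adding the generators of the other presentation to each puts both on common generators; stacking
-- the relations then dominates both ideals.
theorem directedOn_fittSet (M : ModuleCat.{w} R) : DirectedOn (· ≤ ·) (fittSet K R M) := by
  intro I hI J hJ
  obtain ⟨a, b, k, g, hk, rfl⟩ := exists_of_mem_fittSet D hI
  obtain ⟨a', b', k', g', hk', rfl⟩ := exists_of_mem_fittSet D hJ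
  obtain ⟨C, hC⟩ := hk.exists_fromBlocks_one g'
  obtain ⟨C', hC'⟩ := hk'.exists_fromBlocks_one g
  have hC'' := hC'.submatrix_equiv (Equiv.refl _) (Equiv.sumComm (Fin a) (Fin a'))
  have hg : coprodPi g' g ∘ₗ LinearMap.funLeft R R (Equiv.sumComm (Fin a) (Fin a')).symm =
      coprodPi g g' := by
    refine LinearMap.ext fun x => ?_
    rw [LinearMap.comp_apply, coprodPi_apply, coprodPi_apply, add_comm]
    rfl
  rw [hg] at hC''
  refine ⟨_, (hC.fromRows hC'').matrixFitt_mem D, ?_, ?_⟩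
  · exact (matrixFitt_le_fromBlocks_one D k C).trans (matrixFitt_le_fromRows_left K _ _)
  · refine (matrixFitt_le_fromBlocks_one D k' C').trans (le_trans (le_of_eq ?_)
      (matrixFitt_le_fromRows_right K _ _))
    exact (matrixFitt_submatrix_equiv D _ _ _).symm

omit [Fintype α] [DecidableEq α] in
-- A maximal element of a directed set is greatest, and the noetherian ring `𝓘(R)` provides one.
theorem isGreatest_fittMax [Algebra Λ K] [IsScalarTower Λ K A] [IsNoetherianRing Λ]
    [Module.Finite Λ R] (M : ModuleCat.{w} R) [Module.Finite R M] :
    IsGreatest (fittSet K R M) (fittMax K R M) := by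
  have : IsNoetherianRing (normRing K R) := isNoetherianRing_normRing R D
  have : IsNoetherianRing R := IsNoetherianRing.of_finite Λ R
  obtain ⟨a, b, k, g, hk⟩ := exists_isPresentation (R := R) (M := M)
  obtain ⟨I, hI, hmax⟩ := set_has_maximal_iff_noetherian.mpr ‹IsNoetherianRing (normRing K R)›
    (fittSet K R M)
    ⟨_, hk.matrixFitt_mem D⟩
  have hg : IsGreatest (fittSet K R M) I := ⟨hI, fun J hJ => by
    obtain ⟨L, hL, hIL, hJL⟩ := directedOn_fittSet D M I hI J hJ
    rcases hIL.eq_or_lt with h | h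
    · rwa [h]
    · exact absurd h (hmax L hL)⟩
  rwa [fittMax, hg.isLUB.sSup_eq]

/-- Multiplicativity of the maximal Fitting invariant when the quotient has a square presentation
and every square presentation of it has independent rows. -/
theorem fittMax_eq_mul [Algebra Λ K] [IsScalarTower Λ K A] [IsNoetherianRing Λ]
    [Module.Finite Λ R] (M' M P : ModuleCat.{w} R) [Module.Finite R M'] [Module.Finite R M]
    (i : M' →ₗ[R] M) (q : M →ₗ[R] P) (hi : Function.Injective i) (hiq : Function.Exact i q)
    (hq : Function.Surjective q) {H : Matrix α α R} {gP : (α → R) →ₗ[R] P}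
    (hH : IsPresentation H gP)
    (hinj : ∀ (κ : Type) [Fintype κ] [DecidableEq κ] (G : Matrix κ κ R) (g : (κ → R) →ₗ[R] P),
      IsPresentation G g → ∀ x, Matrix.vecMul x G = 0 → x = 0) :
    fittMax K R M = Ideal.span {normElem D H} * fittMax K R M' := by
  have hM := isGreatest_fittMax D M
  have hM' := isGreatest_fittMax D M'
  obtain ⟨y, hy⟩ := Module.projective_lifting_property q gP hq
  replace hy : ∀ x, q (y x) = gP x := LinearMap.congr_fun hy
  apply le_antisymm
  · obtain ⟨a, b, k, g, hk, hkM⟩ := exists_of_mem_fittSet D hM.1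
    -- Put `M` and `P` on the joint generators: those of `M` and the lifts to `M` of those of `P`.
    -- The enlarged matrix `G` of `P` stays square.
    obtain ⟨C, hC⟩ := hk.exists_fromBlocks_one y
    obtain ⟨C', hC'⟩ := hH.exists_fromBlocks_one (q ∘ₗ g)
    have hG := hC'.submatrix_equiv (Equiv.sumComm (Fin a) α) (Equiv.sumComm (Fin a) α)
    set G := (Matrix.fromBlocks H 0 C' 1).submatrix (Equiv.sumComm (Fin a) α)
      (Equiv.sumComm (Fin a) α) with hGdef
    have hg : coprodPi gP (q ∘ₗ g) ∘ₗ LinearMap.funLeft R R (Equiv.sumComm (Fin a) α).symm =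
        q ∘ₗ coprodPi g y := by
      refine LinearMap.ext fun x => ?_
      rw [LinearMap.comp_apply, LinearMap.comp_apply, coprodPi_apply, coprodPi_apply, map_add, hy,
        add_comm]
      rfl
    rw [hg] at hG
    obtain ⟨k', g', hkk, hk'⟩ := hC.exists_eq_mul i q hi hiq hG (hinj _ G _ hG)
    have hN : normElem D G = normElem D H := by
      apply Subtype.ext
      change nrR K R G = nrR K R H
      rw [hGdef, nrR_submatrix_equiv R D, nrR_fromBlocks_zero₁₂ R D, nrR_one R D, mul_one]
    rw [hkM]
    refine (matrixFitt_le_fromBlocks_one D k C).trans ?_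
    rw [hkk]
    refine (matrixFitt_mul_le D k' G).trans ?_
    rw [hN]
    exact Ideal.mul_mono_right (hM'.2 (hk'.matrixFitt_mem D))
  · obtain ⟨a, b, k, g, hk, hkM⟩ := exists_of_mem_fittSet D hM'.1
    obtain ⟨C, hC⟩ := hk.exists_fromBlocks hH i q hi hiq y hy
    rw [hkM]
    exact (mul_matrixFitt_le_fromBlocks D k C H).trans (hM.2 (hC.matrixFitt_mem D))

end MatrixFitting

/-! ### Consequences of torsion -/

section Torsion

variable {Λ : Type u} {K : Type v} {A : Type w} [CommRing Λ] [Field K] [Ring A] [Algebra K A]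
  [Algebra Λ A] {R : Subalgebra Λ A} {S : Submonoid Λ}
  {α : Type} [Fintype α] [DecidableEq α]

/-- The product `s` of annihilators of the generators kills them all, so each `s eⱼ` is a
combination of the rows of `H`. -/
theorem IsPresentation.exists_mul_eq_scalar {P : Type*} [AddCommGroup P] [Module R P]
    {H : Matrix α α R} {g : (α → R) →ₗ[R] P} (h : IsPresentation H g)
    (hP : ∀ p : P, ∃ s ∈ S.map (algebraMap Λ R), s • p = 0) :
    ∃ s ∈ S, ∃ X : Matrix α α R, X * H = Matrix.scalar α (algebraMap Λ R s) := by
  have hP' : ∀ p : P, ∃ s ∈ S, algebraMap Λ R s • p = 0 := fun p => by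
    obtain ⟨_, ⟨s, hs, rfl⟩, h⟩ := hP p
    exact ⟨s, hs, h⟩
  choose s hs hsp using fun j : α => hP' (g (Pi.single j 1))
  have hrow : ∀ j, ∃ y, Matrix.vecMul y H = Pi.single j (algebraMap Λ R (∏ i, s i)) := by
    intro j
    refine (h.exact _).mp ?_
    rw [← mul_one (algebraMap Λ R (∏ i, s i)), ← smul_eq_mul, Pi.single_smul, map_smul,
      ← Finset.prod_erase_mul _ _ (Finset.mem_univ j), map_mul, mul_smul, hsp, smul_zero]
  choose X hX using hrow
  refine ⟨∏ i, s i, S.prod_mem fun i _ => hs i, Matrix.of X, ?_⟩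
  refine Matrix.ext fun i j => (congrFun (hX i) j).trans ?_
  rw [Matrix.scalar_apply, Matrix.diagonal_apply, Pi.single_apply]
  simp only [eq_comm]

/-- Over `A` the matrix `s⁻¹ X` is a left inverse of `H`, so multiplication by `H` on row vectors is
surjective, hence injective by finite dimension over `K`. -/
theorem vecMul_injective_of_mul_eq_scalar [Algebra Λ K] [FaithfulSMul Λ K] [IsScalarTower Λ K A]
    [Module.Finite K A] {s : Λ} (hs : s ≠ 0) {X H : Matrix α α R}
    (h : X * H = Matrix.scalar α (algebraMap Λ R s)) (x : α → R) (hx : Matrix.vecMul x H = 0) :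
    x = 0 := by
  let c : R → A := fun r => r
  let f : (α → A) →ₗ[K] (α → A) := (H.map c).vecMulLinear.restrictScalars K
  have hf : Function.Surjective f := by
    intro w
    let k := algebraMap Λ K s
    have hk : k ≠ 0 := (map_ne_zero_iff _ (FaithfulSMul.algebraMap_injective Λ K)).mpr hs
    refine ⟨k⁻¹ • Matrix.vecMul w (X.map c), ?_⟩
    have hXH : X.map c * H.map c = k • 1 := by
      rw [← map_coe_mul, h]
      ext i j
      by_cases hij : i = j
      · subst hij
        simp [k, Algebra.smul_def, ← IsScalarTower.algebraMap_apply]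
      · simp [hij]
    rw [map_smul]
    change k⁻¹ • Matrix.vecMul (Matrix.vecMul w (X.map c)) (H.map c) = w
    rw [Matrix.vecMul_vecMul, hXH, Matrix.vecMul_smul, Matrix.vecMul_one, smul_smul,
      inv_mul_cancel₀ hk, one_smul]
  have hinj := LinearMap.injective_iff_surjective.mpr hf
  have h0 : f (c ∘ x) = 0 := by
    ext j
    have := congrArg (R.val : R →+* A) (congrFun hx j)
    rw [RingHom.map_vecMul] at this
    exact this
  have h1 := hinj (h0.trans (map_zero f).symm)
  ext j
  exact congrFun h1 j

variable (K) in
/-- The scalar matrix of an element of `S` has reduced norm in the multiplicative set. -/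
theorem normElem_scalar_mem (D : Splitting K (SeparableClosure K) A) {s : Λ} (hs : s ∈ S) :
    normElem D (Matrix.scalar α (algebraMap Λ R s)) ∈ nrSubmonoid K R S := by
  -- The set `S̄` is defined with matrices of size one; a scalar matrix of size `a` has the `a`-th
  -- power of that norm.
  have key : ∀ a : ℕ, normElem D (Matrix.scalar (Fin a) (algebraMap Λ R s)) ∈
      nrSubmonoid K R S := by
    intro a
    induction a with
    | zero =>
      have : normElem D (Matrix.scalar (Fin 0) (algebraMap Λ R s)) = 1 :=
        Subtype.ext ((congrArg (nrR K R) (Subsingleton.elim _ 1)).trans (nrR_one R D))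
      rw [this]
      exact one_mem _
    | succ a ih =>
      have h1 : normElem D (Matrix.scalar (Fin 1) (algebraMap Λ R s)) ∈ nrSubmonoid K R S := by
        refine Submonoid.subset_closure ⟨s, hs, ?_⟩
        refine congrArg (nrR K R) ?_
        ext i j
        rw [Subsingleton.elim i j]
        simp
      have h2 : normElem D (Matrix.scalar (Fin (a + 1)) (algebraMap Λ R s)) =
          normElem D (Matrix.scalar (Fin a) (algebraMap Λ R s)) *
            normElem D (Matrix.scalar (Fin 1) (algebraMap Λ R s)) := by
        apply Subtype.ext
        change nrR K R _ = nrR K R _ * nrR K R _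
        rw [← nrR_fromBlocks_zero₁₂ R D _ 0, ← nrR_submatrix_equiv R D finSumFinEquiv.symm]
        congr 1
        rw [Matrix.scalar_apply, Matrix.scalar_apply, Matrix.scalar_apply,
          Matrix.fromBlocks_diagonal, Matrix.submatrix_diagonal_equiv]
        congr 1
        ext i
        rcases finSumFinEquiv.surjective i with ⟨i | i, rfl⟩ <;> simp
      rw [h2]
      exact mul_mem ih h1
  have : normElem D (Matrix.scalar α (algebraMap Λ R s)) =
      normElem D (Matrix.scalar (Fin (Fintype.card α)) (algebraMap Λ R s)) := by
    apply Subtype.ext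
    change nrR K R _ = nrR K R _
    rw [← nrR_submatrix_equiv R D (Fintype.equivFin α).symm]
    congr 1
    exact Matrix.submatrix_diagonal_equiv _ _
  rw [this]
  exact key _

/-- `nr H` divides the norm of a scalar matrix `s`, which is inverted in the localization. -/
theorem isUnit_algebraMap_normElem (D : Splitting K (SeparableClosure K) A) {s : Λ} (hs : s ∈ S)
    {X H : Matrix α α R} (h : X * H = Matrix.scalar α (algebraMap Λ R s)) :
    IsUnit (algebraMap (normRing K R) (Localization (nrSubmonoid K R S)) (normElem D H)) := by
  have hmul : normElem D X * normElem D H = normElem D (Matrix.scalar α (algebraMap Λ R s)) :=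
    Subtype.ext ((nrR_mul R D X H).symm.trans (congrArg _ h))
  have hu := IsLocalization.map_units (Localization (nrSubmonoid K R S))
    ⟨_, normElem_scalar_mem (α := α) (R := R) K D hs⟩
  replace hu : IsUnit (algebraMap (normRing K R) (Localization (nrSubmonoid K R S))
    (normElem D (Matrix.scalar α (algebraMap Λ R s)))) := hu
  rw [← hmul, map_mul] at hu
  exact isUnit_of_mul_isUnit_right hu

theorem fittMax_eq_top (D : Splitting K (SeparableClosure K) A) (M : ModuleCat.{w} R)
    [Subsingleton M] : fittMax K R M = ⊤ := by
  have h : IsPresentation (1 : Matrix (Fin 0) (Fin 0) R) (0 : (Fin 0 → R) →ₗ[R] M) :=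
    ⟨fun _ => ⟨0, Subsingleton.elim _ _⟩, fun x => ⟨fun _ => ⟨x, Subsingleton.elim _ _⟩,
      fun _ => rfl⟩⟩
  refine eq_top_iff.mpr (le_trans ?_ (le_sSup (h.matrixFitt_mem D)))
  rw [← Ideal.span_singleton_one, Ideal.span_le, Set.singleton_subset_iff]
  exact Ideal.subset_span ⟨id, (nrR_one R D).symm⟩

end Torsion

end NCFitting

/-! ### The theorem -/

theorem mainTheorem3 {Λ : Type u} {K : Type v} {A : Type w}
    [CommRing Λ] [IsDomain Λ] [IsNoetherianRing Λ] [IsLocalRing Λ]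
    [IsAdicComplete (IsLocalRing.maximalIdeal Λ) Λ]
    [Field K] [Algebra Λ K] [IsFractionRing Λ K]
    [Ring A] [Algebra K A] [Algebra Λ A] [IsScalarTower Λ K A]
    (hA : NCFitting.IsSeparableAlgebra K A)
    (R : Subalgebra Λ A) (hR : NCFitting.IsOrder K R)
    (S : Submonoid Λ) (hS : (0 : Λ) ∉ S)
    (hquad : ∀ P : NCFitting.TorsionModule (S.map (algebraMap Λ R)),
      NCFitting.InP P.obj → NCFitting.HasQuadraticPresentation P.obj) :
    (∀ M : ModuleCat.{w} R, Module.Finite R M →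
      IsGreatest (NCFitting.fittSet K R M) (NCFitting.fittMax K R M)) ∧
    ∃ F : NCFitting.TorsionModule (S.map (algebraMap Λ R)) → NCFitting.fracIdeals K R S,
      (∀ M, (F M : Submodule (NCFitting.normRing K R)
          (Localization (NCFitting.nrSubmonoid K R S))) =
        IsLocalization.coeSubmodule (Localization (NCFitting.nrSubmonoid K R S))
          (NCFitting.fittMax K R M.obj)) ∧
      NCFitting.IsFittingInvariant (S.map (algebraMap Λ R)) F := by
  open NCFitting in
  have := hA.finite
  have := hR.finite
  obtain ⟨D⟩ := hA.nonempty_splitting (SeparableClosure K)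
  have hnoeth := isNoetherianRing_normRing R D
  let L := Localization (nrSubmonoid K R S)
  -- The Fitting ideals of torsion modules with a square presentation.
  have hpres : ∀ P : TorsionModule (S.map (algebraMap Λ R)), InP P.obj →
      ∃ (a : ℕ) (H : Matrix (Fin a) (Fin a) R),
        IsUnit (algebraMap (normRing K R) L (normElem D H)) ∧
        fittMax K R P.obj = Ideal.span {normElem D H} ∧
        ∀ (M' M : TorsionModule (S.map (algebraMap Λ R))) (i : M'.obj →ₗ[R] M.obj)
          (q : M.obj →ₗ[R] P.obj), Function.Injective i → Function.Exact i q →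
          Function.Surjective q →
          fittMax K R M.obj = Ideal.span {normElem D H} * fittMax K R M'.obj := by
    intro P hP
    obtain ⟨a, h, g, hex, hg⟩ := hquad P hP
    have hH : IsPresentation (LinearMap.toMatrixRight' h) g := ⟨hg, fun x => (hex x).trans
      (exists_congr fun y => by
        rw [show Matrix.vecMul y (LinearMap.toMatrixRight' h) = h y from
          LinearMap.congr_fun (LinearMap.toMatrixRight'.symm_apply_apply h) y])⟩
    obtain ⟨s, hs, X, hX⟩ := hH.exists_mul_eq_scalar P.property.2
    have hmul : ∀ (M' M : TorsionModule (S.map (algebraMap Λ R))) (i : M'.obj →ₗ[R] M.obj)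
        (q : M.obj →ₗ[R] P.obj), Function.Injective i → Function.Exact i q →
        Function.Surjective q → fittMax K R M.obj =
          Ideal.span {normElem D (LinearMap.toMatrixRight' h)} * fittMax K R M'.obj := ?_
    -- Multiplicativity for `0 → 0 → P → P → 0` computes the ideal of `P`, as the zero module has
    -- the unit ideal.
    · let Z : TorsionModule (S.map (algebraMap Λ R)) :=
        ⟨ModuleCat.of R PUnit, inferInstance, fun _ => ⟨1, one_mem _, Subsingleton.elim _ _⟩⟩
      refine ⟨a, _, isUnit_algebraMap_normElem D hs hX, ?_, hmul⟩
      rw [hmul Z P 0 LinearMap.id (fun _ _ _ => Subsingleton.elim _ _)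
        (fun x => ⟨fun hx => ⟨0, hx.symm⟩, fun ⟨_, hx⟩ => hx.symm⟩) Function.surjective_id,
        fittMax_eq_top D (ModuleCat.of R PUnit), Ideal.mul_top]
    intro M' M i q hi hiq hq
    have := M'.property.1
    have := M.property.1
    refine fittMax_eq_mul D M'.obj M.obj P.obj i q hi hiq hq hH fun κ _ _ G g' hG => ?_
    obtain ⟨t, ht, Y, hY⟩ := hG.exists_mul_eq_scalar P.property.2
    exact vecMul_injective_of_mul_eq_scalar (K := K) (fun h0 => hS (h0 ▸ ht)) hY
  refine ⟨fun M _ => isGreatest_fittMax D M, fun M => ⟨IsLocalization.coeSubmodule L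
    (fittMax K R M.obj), (IsNoetherian.noetherian (fittMax K R M.obj)).map _⟩, fun _ => rfl, ?_, ?_⟩
  · intro P hP
    obtain ⟨a, H, hu, hP', -⟩ := hpres P hP
    obtain ⟨b, hb⟩ := hu.exists_right_inv
    -- The inverse is generated by the inverse `b` of the image of `nr H`.
    refine IsUnit.of_mul_eq_one ⟨Submodule.span _ {b}, Submodule.fg_span_singleton _⟩
      (Subtype.ext ?_)
    change IsLocalization.coeSubmodule L (fittMax K R P.obj) * Submodule.span _ {b} = 1
    rw [hP', IsLocalization.coeSubmodule_span_singleton, Submodule.span_mul_span,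
      Set.singleton_mul_singleton, hb, Submodule.one_eq_span]
  · intro M' M P i q hi hiq hq hP
    obtain ⟨a, H, -, hP', hmul⟩ := hpres P hP
    refine Subtype.ext ?_
    change IsLocalization.coeSubmodule L (fittMax K R M.obj) =
      IsLocalization.coeSubmodule L (fittMax K R P.obj) *
        IsLocalization.coeSubmodule L (fittMax K R M'.obj)
    rw [← IsLocalization.coeSubmodule_mul, hP', hmul M' M i q hi hiq hq]
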